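/- Let $0<\alpha<1$, $\theta\in\mathbb{R}$, $p\ge 1$ an integer, and define $\theta_0,\dots,\theta_{p-1}$ by $$\Theta(\xi):=\sum_{j=0}^{p-1}\theta_j\xi^j=\sum_{i=0}^{p-1}(-1)^i\binom{\theta}{i}(1-\xi)^i .$$ Say that $(\omega_n)_{n\ge0}\subset\mathbb{C}$ are weights of order $\beta\in\mathbb{R}$ if $\omega(\xi)=\sum_{n\ge0}\omega_n\xi^n$ converges for $|\xi|<1$ and there $$\omega(\xi)=\nu(\xi)\prod_{j=0}^{\ell}(\xi-\xi_j)^{-a_j},\qquad \xi_0=1,\quad a_0=\beta,$$ (branches of the powers analytic in $|\xi|<1$), where the $\xi_j$ are distinct with $|\xi_j|=1$, $\nu$ is analytic on a neighbourhood of $|\xi|\le1$ with $\nu(\xi_j)\ne0$, and $a_j\in\mathbb{C}\setminus\{0,-1,-2,\dots\}$, $\operatorname{Re}a_j\le\beta$, $\operatorname{Re}a_j\neq0$. Assume further that $\omega$ and $\Theta$ have no common zero in $|\xi|\le1$ (on $|\xi|=1$, zeros of $\omega$ are understood through limits from $|\xi|<1$). Put $z=\lambda h^\alpha$ with $h>0$,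 $\lambda\in\mathbb{C}$. Scheme-I (for the Caputo equation ${}_CD^\alpha y=\lambda y$, $y(0)=y_0$; weights of order $-\alpha$): $$\sum_{k=0}^{n}\omega_{n-k}y^k=z\sum_{j=0}^{p-1}\theta_jy^{n-j}+\frac{y_0}{(n-\theta)^\alpha\,\Gamma(1-\alpha)},\qquad y^0=y_0 .$$ Scheme-II (for $I^\alpha y=\frac1\lambda y$, $\lambda\ne0$, $I^\alpha$ the Riemann–Liouville integral; weights of order $\alpha$): $$z\sum_{k=0}^{n}\omega_{n-k}y^k=\sum_{j=0}^{p-1}\theta_jy^{n-j}.$$ A numerical solution with $m$ starting values, where $m\ge1$, $m\ge p-1$ and, for Scheme-I, $m>\theta$, is a sequence $(y^n)_{n\ge0}$ with prescribed $y^0,\dots,y^{m-1}\in\mathbb{C}$ that satisfies the scheme for all $n\ge m$. The stability region $S$ of a scheme is the set of all $z=\lambda h^\alpha$ ($\lambda\neq 0$ for Scheme-II) such that for every such $m$ and all starting values a numerical solution exists and every numerical solution satisfies $y^n\to0$ as $n\to\infty$. Then the stability regions are $$\text{Scheme-I:}\quad S=\mathbb{C}\setminus\Big\{\omega(\xi)\Big/\sum_{j=0}^{p-1}\theta_j\xi^j:\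 |\xi|\le1\Big\},\qquad \text{Scheme-II:}\quad S=\mathbb{C}\setminus\Big\{\sum_{j=0}^{p-1}\theta_j\xi^j\Big/\omega(\xi):\ |\xi|\le1\Big\}.$$ Here the quotients at $|\xi|=1$ are the limits from within $|\xi|<1$, and only finite values are counted (a point $\xi$ at which the quotient has a pole contributes nothing; in Scheme-II the point $\xi=1$, where $\omega=\infty$, contributes the value $0$). -/

import Mathlib

open Filter Topology

noncomputable section

namespace SCQ

/-- The power series `ω(ζ) = ∑ ωₙ ζⁿ` of a sequence of weights (used for `|ζ| < 1` only). -/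
def genFun (ω : ℕ → ℂ) (ζ : ℂ) : ℂ := ∑' n, ω n * ζ ^ n

/-- The weights `ω` of a stable shifted convolution quadrature for the operator `I^β`, with
generating function `ω(ζ) = ν(ζ) ∏ⱼ (ζ - ξⱼ)^(-aⱼ)`: here `ξ₀ = 1`, `a₀ = β`, the `ξⱼ` are distinct
points of the unit circle, `aⱼ ∉ {0, -1, -2, …}`, `Re aⱼ ≤ β`, and `ν` is analytic on the closed
unit disc with `ν(ξⱼ) ≠ 0`. The branch of each power that is analytic in the unit disc is unique up
to a constant, which belongs to `ν`; the one taken is the principal value of `(1 - ζ / ξⱼ)^(-aⱼ)`.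
The condition `Re aⱼ ≠ 0` says that `ω` has a limit, zero or infinity, at `ξⱼ`. -/
def IsWeights (β : ℝ) (ω : ℕ → ℂ) : Prop :=
  ∃ (l : ℕ) (ξ a : Fin (l + 1) → ℂ) (ν : ℂ → ℂ),
    ξ 0 = 1 ∧ a 0 = (β : ℂ) ∧
    Function.Injective ξ ∧ (∀ j, ‖ξ j‖ = 1) ∧
    (∀ j, ∀ k : ℕ, a j ≠ -(k : ℂ)) ∧ (∀ j, (a j).re ≠ 0) ∧ (∀ j, (a j).re ≤ β) ∧
    AnalyticOnNhd ℂ ν (Metric.closedBall 0 1) ∧ (∀ j, ν (ξ j) ≠ 0) ∧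
    ∀ ζ : ℂ, ‖ζ‖ < 1 →
      HasSum (fun n => ω n * ζ ^ n) (ν ζ * ∏ j, (1 - ζ / ξ j) ^ (-(a j)))

/-- The polynomial `∑_{j<p} θⱼ ξ^j = ∑_{i<p} γᵢ (1 - ξ)^i`, where `γᵢ = (-1)^i (θ choose i)` are the
coefficients of `ξ^θ = ∑ᵢ γᵢ (1 - ξ)^i`. -/
def shiftPoly (θ : ℝ) (p : ℕ) : Polynomial ℂ :=
  ∑ i ∈ Finset.range p,
    Polynomial.C (((-1 : ℝ) ^ i * Ring.choose θ i : ℝ) : ℂ) * (1 - Polynomial.X) ^ i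

/-- The weights `θⱼ` of the approximation `f(x_{n-θ}) ≈ ∑_{j<p} θⱼ f(x_{n-j})`. -/
def shiftCoeff (θ : ℝ) (p : ℕ) (j : ℕ) : ℂ := (shiftPoly θ p).coeff j

/-- The source term `f(x_{n-θ}) = y₀ / ((n - θ)^α Γ(1 - α))`. -/
def source (α θ : ℝ) (y₀ : ℂ) (n : ℕ) : ℂ :=
  y₀ / ((((n : ℝ) - θ) ^ α * Real.Gamma (1 - α) : ℝ) : ℂ)

/-- `y` satisfies the equations of Scheme-I with index `n ≥ m`; the initial value is `y₀ = y 0`. -/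
def SolvesI (α θ : ℝ) (p : ℕ) (ω : ℕ → ℂ) (z : ℂ) (m : ℕ) (y : ℕ → ℂ) : Prop :=
  ∀ n, m ≤ n → ∑ k ∈ Finset.range (n + 1), ω (n - k) * y k =
    z * ∑ j ∈ Finset.range p, shiftCoeff θ p j * y (n - j) + source α θ (y 0) n

/-- `y` satisfies the equations of Scheme-II with index `n ≥ m`. -/
def SolvesII (θ : ℝ) (p : ℕ) (ω : ℕ → ℂ) (z : ℂ) (m : ℕ) (y : ℕ → ℂ) : Prop :=
  ∀ n, m ≤ n → z * ∑ k ∈ Finset.range (n + 1), ω (n - k) * y k =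
    ∑ j ∈ Finset.range p, shiftCoeff θ p j * y (n - j)

/-- The stability region of Scheme-I for `D^α y = λ y`: the set of all `z = λ h^α` such that, for
every number `m` of starting values for which the equations with `n ≥ m` make sense (no negative
index occurs and `x_{n-θ} > 0`), and for all starting values `y 0, …, y (m - 1)`, there is a
numerical solution, and every one tends to `0`. -/
def stabilityRegionI (α θ : ℝ) (p : ℕ) (ω : ℕ → ℂ) : Set ℂ :=
  {z | ∃ (lam : ℂ) (h : ℝ), 0 < h ∧ z = lam * ((h ^ α : ℝ) : ℂ) ∧
    ∀ m : ℕ, 1 ≤ m → p ≤ m + 1 → θ < m → ∀ s : Fin m → ℂ,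
      (∃ y : ℕ → ℂ, (∀ k : Fin m, y k = s k) ∧ SolvesI α θ p ω z m y) ∧
      ∀ y : ℕ → ℂ, (∀ k : Fin m, y k = s k) → SolvesI α θ p ω z m y →
        Tendsto y atTop (𝓝 0)}

/-- The stability region of Scheme-II for `I^α y = y / λ`, `λ ≠ 0`: the set of all `z = λ h^α` such
that, for every number `m ≥ 1` of starting values for which no negative index occurs in the
equations with `n ≥ m`, and for all starting values `y 0, …, y (m - 1)`, there is a numerical
solution, and every one tends to `0`. -/
def stabilityRegionII (α θ : ℝ) (p : ℕ) (ω : ℕ → ℂ) : Set ℂ :=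
  {z | ∃ (lam : ℂ) (h : ℝ), lam ≠ 0 ∧ 0 < h ∧ z = lam * ((h ^ α : ℝ) : ℂ) ∧
    ∀ m : ℕ, 1 ≤ m → p ≤ m + 1 → ∀ s : Fin m → ℂ,
      (∃ y : ℕ → ℂ, (∀ k : Fin m, y k = s k) ∧ SolvesII θ p ω z m y) ∧
      ∀ y : ℕ → ℂ, (∀ k : Fin m, y k = s k) → SolvesII θ p ω z m y →
        Tendsto y atTop (𝓝 0)}

/-- The finite values `g(ξ)`, `|ξ| ≤ 1`, of a quotient `g` of two functions that are analytic in the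
open unit disc, where `g(ξ)` is the limit of `g` at `ξ` from within the open disc (the usual value
if `|ξ| < 1` and the denominator is not `0` at `ξ`; none if `g` has a pole at `ξ`). -/
def closedDiscValues (g : ℂ → ℂ) : Set ℂ :=
  {z | ∃ ξ : ℂ, ‖ξ‖ ≤ 1 ∧ Tendsto g (𝓝[Metric.ball 0 1] ξ) (𝓝 z)}

/-- `ω(ξ)` and `∑ θⱼ ξ^j` do not vanish at the same point `ξ` of the closed unit disc. -/
def NoCommonZero (θ : ℝ) (p : ℕ) (ω : ℕ → ℂ) : Prop :=
  ∀ ξ : ℂ, ‖ξ‖ ≤ 1 → Tendsto (genFun ω) (𝓝[Metric.ball 0 1] ξ) (𝓝 0) →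
    (shiftPoly θ p).eval ξ ≠ 0

end SCQ

end

namespace SCQ

open PowerSeries ZeroAtInfty

/-! In terms of generating functions, the equations with `n ≥ m` prescribe the coefficients of `D ·
Y` from index `m` on: they are `y 0 * c n`, where `c` tends to zero. Here `D = ω - zΘ` for Scheme-I,
and `D = zω - Θ`, `c = 0` for Scheme-II. The question is whether `D` has a zero in the closed disc,
in the sense of limits.

Stability: moving the factors of `ω` with `Re aⱼ > 0` into a denominator gives `ω = N / P`, where
`P` and `N` have absolutely summable coefficients and no common zero
(`IsWeights.exists_factorization`). Then `P · D` is absolutely summable and has no zero in the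
closed disc if `D` has none, so Wiener's lemma on null sequences (`tendsto_coeff_of_mul`) turns `P ·
D · Y → 0` into `Y → 0`.

Instability: if `D(ξ) = 0` and `ξ ≠ 0`, some starting values give `D · Y = X` with `y 0 = 0`. Along
the radius to `ξ`, `D` is `O(1 - r)`, while a null sequence has generating function `o(1 / (1 -
r))`; this contradicts `D · Y = ξ` in the limit. If `D(0) = 0`, solvability itself fails.

What remains is `z = 0`. Scheme-II excludes it by definition. In Scheme-I the singularity of `ω` at
`1` is not differentiable, and the source term, of order `n^(-α)`, is too large to equal `ω · Y` for
a null sequence. -/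

/-! ### Wiener's lemma on null sequences -/

/-- In a complex Banach algebra, an absolutely convergent power series in a contraction is
invertible if it has no zero in the closed unit disc. -/
theorem isUnit_tsum_smul_pow {B : Type*} [NormedRing B] [NormedAlgebra ℂ B] [CompleteSpace B]
    [NormOneClass B] {S : B} (hS : ‖S‖ ≤ 1) {a : ℕ → ℂ} (ha : Summable fun n => ‖a n‖)
    (h0 : ∀ ζ : ℂ, ‖ζ‖ ≤ 1 → ∑' n, a n * ζ ^ n ≠ 0) : IsUnit (∑' n, a n • S ^ n) := by
  let A := Algebra.elemental ℂ S
  -- Gelfand theory needs commutativity, so the argument runs in the closed subalgebra generated by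
  -- `S`.
  let _ : NormedCommRing A := { SubringClass.toNormedRing A with mul_comm := mul_comm }
  have _ : NormOneClass A := ⟨norm_one (α := B)⟩
  let s : A := ⟨S, Algebra.elemental.self_mem ℂ S⟩
  have hs : ‖s‖ ≤ 1 := hS
  have hsum : Summable fun n => a n • s ^ n := by
    refine Summable.of_norm_bounded ha fun n => ?_
    rw [norm_smul]
    exact mul_le_of_le_one_right (norm_nonneg _)
      ((norm_pow_le s n).trans (pow_le_one₀ (norm_nonneg _) hs))
  have hu : IsUnit (∑' n, a n • s ^ n) := by
    -- A non-unit is annihilated by a character `φ`. By continuity `φ` passes through the series,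
    -- which makes `φ s`, of modulus at most 1, a forbidden zero.
    by_contra hn
    obtain ⟨φ, hφ⟩ := WeakDual.CharacterSpace.exists_apply_eq_zero hn
    refine h0 (φ s) ?_ ?_
    · exact (AlgHom.norm_apply_le_self φ s).trans hs
    · have h1 : HasSum (fun n => φ (a n • s ^ n)) (φ (∑' n, a n • s ^ n)) :=
        hsum.hasSum.map φ (map_continuous φ)
      simp only [map_smul, map_pow, smul_eq_mul] at h1
      rw [h1.tsum_eq, hφ]
  have h2 : ((∑' n, a n • s ^ n : A) : B) = ∑' n, a n • S ^ n := by
    have h1 : HasSum (fun n => A.val (a n • s ^ n)) (A.val (∑' n, a n • s ^ n)) :=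
      hsum.hasSum.map A.val continuous_subtype_val
    simp only [map_smul, map_pow] at h1
    exact h1.tsum_eq.symm
  rw [← h2]
  exact hu.map A.val

/-- The Banach space of null sequences. -/
def NullSpace : Type := C₀(ℕ, ℂ)

noncomputable instance : NormedAddCommGroup NullSpace :=
  inferInstanceAs (NormedAddCommGroup C₀(ℕ, ℂ))

noncomputable instance : NormedSpace ℂ NullSpace := inferInstanceAs (NormedSpace ℂ C₀(ℕ, ℂ))

instance : CompleteSpace NullSpace := inferInstanceAs (CompleteSpace C₀(ℕ, ℂ))

instance : FunLike NullSpace ℕ ℂ := inferInstanceAs (FunLike C₀(ℕ, ℂ) ℕ ℂ)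

theorem NullSpace.ext {f g : NullSpace} (h : ∀ n, f n = g n) : f = g := DFunLike.ext f g h

/-- A null sequence as a function vanishing at infinity. -/
noncomputable def nullSeq (f : ℕ → ℂ) (hf : Tendsto f atTop (𝓝 0)) : NullSpace :=
  ZeroAtInftyContinuousMap.mk ⟨f, continuous_of_discreteTopology⟩
    (by rwa [Filter.cocompact_eq_cofinite, Nat.cofinite_eq_atTop])

theorem nullSeq_apply (f : ℕ → ℂ) (hf : Tendsto f atTop (𝓝 0)) (n : ℕ) : nullSeq f hf n = f n :=
  rfl

theorem tendsto_coe (f : NullSpace) : Tendsto f atTop (𝓝 0) := by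
  have := ZeroAtInftyContinuousMap.zero_at_infty' f
  rwa [Filter.cocompact_eq_cofinite, Nat.cofinite_eq_atTop] at this

theorem norm_coe_le (f : NullSpace) (n : ℕ) : ‖f n‖ ≤ ‖f‖ :=
  (ZeroAtInftyContinuousMap.toBCF f).norm_coe_le_norm n

/-- The right shift on null sequences. -/
noncomputable def shift : NullSpace →L[ℂ] NullSpace :=
  LinearMap.mkContinuous
    { toFun := fun f => nullSeq (fun n => if n = 0 then 0 else f (n - 1)) <| by
        rw [← tendsto_add_atTop_iff_nat 1]
        simpa using tendsto_coe f
      map_add' := fun f g => by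
        refine NullSpace.ext fun n => ?_
        change (if n = 0 then (0 : ℂ) else f (n - 1) + g (n - 1)) =
          (if n = 0 then 0 else f (n - 1)) + (if n = 0 then 0 else g (n - 1))
        split_ifs <;> simp
      map_smul' := fun c f => by
        refine NullSpace.ext fun n => ?_
        change (if n = 0 then (0 : ℂ) else c * f (n - 1)) = c * (if n = 0 then 0 else f (n - 1))
        split_ifs <;> simp }
    1 fun f => by
      rw [one_mul]
      refine (BoundedContinuousFunction.norm_le (norm_nonneg f)).2 ?_
      intro n
      change ‖if n = 0 then 0 else f (n - 1)‖ ≤ _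
      split_ifs
      · simp
      · exact norm_coe_le _ _

theorem shift_apply (f : NullSpace) (n : ℕ) : shift f n = if n = 0 then 0 else f (n - 1) := rfl

theorem norm_shift_le : ‖shift‖ ≤ 1 := LinearMap.mkContinuous_norm_le _ zero_le_one _

theorem shift_pow_apply (k : ℕ) (f : NullSpace) (n : ℕ) :
    (shift ^ k) f n = if n < k then 0 else f (n - k) := by
  induction k generalizing n with
  | zero => simp
  | succ k ih =>
    rw [pow_succ', mul_apply_eq_comp, shift_apply, ih]
    rcases n with _ | n
    · simp
    · simp

instance : Nontrivial NullSpace := by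
  refine ⟨⟨0, nullSeq (fun n => if n = 0 then 1 else 0) ?_, fun h => ?_⟩⟩
  · rw [← tendsto_add_atTop_iff_nat 1]
    simp
  · have := congrArg (fun f : NullSpace => f 0) h
    exact zero_ne_one this

/-- Convolution by a power series with absolutely summable coefficients. -/
noncomputable def convCLM (φ : ℂ⟦X⟧) : NullSpace →L[ℂ] NullSpace := ∑' n, coeff n φ • shift ^ n

theorem convCLM_apply {φ : ℂ⟦X⟧} (hφ : Summable fun n => ‖coeff n φ‖) (f : NullSpace) (n : ℕ) :
    convCLM φ f n = coeff n (φ * PowerSeries.mk f) := by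
  have hsum : Summable fun n => coeff n φ • shift ^ n := by
    refine Summable.of_norm_bounded hφ fun n => ?_
    rw [norm_smul]
    exact mul_le_of_le_one_right (norm_nonneg _)
      ((norm_pow_le shift n).trans (pow_le_one₀ (norm_nonneg _) norm_shift_le))
  -- Evaluation at `f` and `n` is continuous, so it commutes with the operator series; only the
  -- shifts by `k ≤ n` contribute.
  let ev : (NullSpace →L[ℂ] NullSpace) →+ ℂ :=
    { toFun := fun T => T f n
      map_zero' := rfl
      map_add' := fun _ _ => rfl }
  have hev : Continuous ev := by
    refine (AddMonoidHomClass.continuous_of_bound ev ‖f‖ fun T => ?_)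
    rw [mul_comm]
    exact (norm_coe_le _ n).trans (T.le_opNorm f)
  have h := hsum.hasSum.map ev hev
  have h2 : HasSum (ev ∘ fun n => coeff n φ • shift ^ n)
      (∑ k ∈ Finset.range (n + 1), (ev ∘ fun n => coeff n φ • shift ^ n) k) := by
    refine hasSum_sum_of_ne_finset_zero fun k hk => ?_
    have hk' : n < k := by simpa using hk
    change coeff k φ * (shift ^ k) f n = 0
    rw [shift_pow_apply, if_pos hk', mul_zero]
  have h3 : convCLM φ f n = _ := h.unique h2
  rw [h3, coeff_mul, Finset.Nat.sum_antidiagonal_eq_sum_range_succ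
    (fun i j => coeff i φ * coeff j (PowerSeries.mk f))]
  refine Finset.sum_congr rfl fun k hk => ?_
  have hk' : ¬ n < k := by simpa using hk
  change coeff k φ * (shift ^ k) f n = _
  rw [shift_pow_apply, if_neg hk', coeff_mk]

/-- The convolution of a summable sequence with a null sequence is a null sequence. -/
theorem tendsto_coeff_mul {φ f : ℂ⟦X⟧} (hφ : Summable fun n => ‖coeff n φ‖)
    (hf : Tendsto (fun n => coeff n f) atTop (𝓝 0)) :
    Tendsto (fun n => coeff n (φ * f)) atTop (𝓝 0) := by
  have h : PowerSeries.mk (nullSeq _ hf) = f := by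
    ext n
    simp [nullSeq_apply]
  have h2 := tendsto_coe (convCLM φ (nullSeq _ hf))
  refine h2.congr fun n => ?_
  rw [convCLM_apply hφ, h]

/-- A form of Wiener's lemma: deconvolution by a summable sequence whose generating function has no
zero in the closed unit disc preserves null sequences. -/
theorem tendsto_coeff_of_mul {φ y : ℂ⟦X⟧} (hφ : Summable fun n => ‖coeff n φ‖)
    (h0 : ∀ ζ : ℂ, ‖ζ‖ ≤ 1 → ∑' n, coeff n φ * ζ ^ n ≠ 0)
    (hy : Tendsto (fun n => coeff n (φ * y)) atTop (𝓝 0)) :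
    Tendsto (fun n => coeff n y) atTop (𝓝 0) := by
  have hu : IsUnit (convCLM φ) := isUnit_tsum_smul_pow norm_shift_le hφ h0
  obtain ⟨T, hT⟩ := hu.exists_right_inv
  let g := T (nullSeq _ hy)
  have hg : convCLM φ g = nullSeq _ hy := by
    change (convCLM φ * T) _ = _
    rw [hT]
    rfl
  have h1 : φ * PowerSeries.mk g = φ * y := by
    ext n
    rw [← convCLM_apply hφ, hg]
    rfl
  have hφ0 : φ ≠ 0 := by
    rintro rfl
    exact h0 0 (by simp) (by simp)
  have h2 := mul_left_cancel₀ hφ0 h1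
  rw [← h2]
  simpa using tendsto_coe g

/-! ### Power series on the open and closed disc -/

/-- `F` is the sum of the power series `φ` in the open unit disc. -/
def OnDisc (φ : ℂ⟦X⟧) (F : ℂ → ℂ) : Prop :=
  ∀ ζ : ℂ, ‖ζ‖ < 1 → HasSum (fun n => coeff n φ * ζ ^ n) (F ζ)

/-- `φ` has absolutely summable coefficients and `F` is its sum in the closed unit disc. -/
structure OnClosedDisc (φ : ℂ⟦X⟧) (F : ℂ → ℂ) : Prop where
  summable : Summable fun n => ‖coeff n φ‖
  hasSum : ∀ ζ : ℂ, ‖ζ‖ ≤ 1 → HasSum (fun n => coeff n φ * ζ ^ n) (F ζ)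

theorem hasSum_coeff_mul {φ ψ : ℂ⟦X⟧} {ζ A B : ℂ} (hφ : HasSum (fun n => coeff n φ * ζ ^ n) A)
    (hψ : HasSum (fun n => coeff n ψ * ζ ^ n) B) :
    HasSum (fun n => coeff n (φ * ψ) * ζ ^ n) (A * B) := by
  have h1 := summable_norm_sum_mul_antidiagonal_of_summable_norm hφ.summable.norm hψ.summable.norm
  have h2 := tsum_mul_tsum_eq_tsum_sum_antidiagonal_of_summable_norm
    hφ.summable.norm hψ.summable.norm
  rw [hφ.tsum_eq, hψ.tsum_eq] at h2
  rw [h2]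
  convert! h1.of_norm.hasSum using 2 with n
  rw [coeff_mul, Finset.sum_mul]
  refine Finset.sum_congr rfl fun kl hkl => ?_
  rw [← Finset.HasAntidiagonal.mem_antidiagonal.1 hkl, pow_add]
  ring

theorem OnDisc.mul {φ ψ : ℂ⟦X⟧} {F G : ℂ → ℂ} (hφ : OnDisc φ F) (hψ : OnDisc ψ G) :
    OnDisc (φ * ψ) fun ζ => F ζ * G ζ :=
  fun ζ hζ => hasSum_coeff_mul (hφ ζ hζ) (hψ ζ hζ)

theorem OnDisc.add {φ ψ : ℂ⟦X⟧} {F G : ℂ → ℂ} (hφ : OnDisc φ F) (hψ : OnDisc ψ G) :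
    OnDisc (φ + ψ) fun ζ => F ζ + G ζ := fun ζ hζ => by
  simpa only [map_add, add_mul] using (hφ ζ hζ).add (hψ ζ hζ)

theorem OnDisc.congr {φ : ℂ⟦X⟧} {F G : ℂ → ℂ} (hφ : OnDisc φ F)
    (h : ∀ ζ : ℂ, ‖ζ‖ < 1 → F ζ = G ζ) : OnDisc φ G :=
  fun ζ hζ => h ζ hζ ▸ hφ ζ hζ

theorem OnDisc.eqOn {φ : ℂ⟦X⟧} {F G : ℂ → ℂ} (hF : OnDisc φ F) (hG : OnDisc φ G) {ζ : ℂ}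
    (hζ : ‖ζ‖ < 1) : F ζ = G ζ :=
  (hF ζ hζ).unique (hG ζ hζ)

/-- The identity theorem for power series; it turns equalities of functions in the disc into
equalities of formal series. -/
theorem OnDisc.unique {φ ψ : ℂ⟦X⟧} {F : ℂ → ℂ} (hφ : OnDisc φ F) (hψ : OnDisc ψ F) : φ = ψ := by
  have key : ∀ χ : ℂ⟦X⟧, OnDisc χ F → HasFPowerSeriesAt F
      (FormalMultilinearSeries.ofScalars ℂ fun n => coeff n χ) 0 := by
    intro χ hχ
    rw [hasFPowerSeriesAt_iff]
    filter_upwards [Metric.ball_mem_nhds (0 : ℂ) one_pos] with ζ hζ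
    have := hχ ζ (by simpa using hζ)
    simpa [FormalMultilinearSeries.coeff_ofScalars, mul_comm] using this
  have h := (key φ hφ).eq_formalMultilinearSeries (key ψ hψ)
  ext n
  have := congrArg (fun p => FormalMultilinearSeries.coeff p n) h
  simpa [FormalMultilinearSeries.coeff_ofScalars] using this

theorem OnClosedDisc.onDisc {φ : ℂ⟦X⟧} {F : ℂ → ℂ} (h : OnClosedDisc φ F) : OnDisc φ F :=
  fun ζ hζ => h.hasSum ζ hζ.le

theorem OnClosedDisc.mul {φ ψ : ℂ⟦X⟧} {F G : ℂ → ℂ} (hφ : OnClosedDisc φ F)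
    (hψ : OnClosedDisc ψ G) : OnClosedDisc (φ * ψ) fun ζ => F ζ * G ζ where
  summable := by
    simpa only [coeff_mul] using
      summable_norm_sum_mul_antidiagonal_of_summable_norm hφ.summable hψ.summable
  hasSum ζ hζ := hasSum_coeff_mul (hφ.hasSum ζ hζ) (hψ.hasSum ζ hζ)

theorem OnClosedDisc.add {φ ψ : ℂ⟦X⟧} {F G : ℂ → ℂ} (hφ : OnClosedDisc φ F)
    (hψ : OnClosedDisc ψ G) : OnClosedDisc (φ + ψ) fun ζ => F ζ + G ζ where
  summable := by
    refine (hφ.summable.add hψ.summable).of_nonneg_of_le (fun n => norm_nonneg _) fun n => ?_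
    rw [map_add]
    exact norm_add_le _ _
  hasSum ζ hζ := by
    simpa only [map_add, add_mul] using (hφ.hasSum ζ hζ).add (hψ.hasSum ζ hζ)

theorem onClosedDisc_polynomial (p : Polynomial ℂ) :
    OnClosedDisc (p : ℂ⟦X⟧) fun ζ => p.eval ζ := by
  have hz : ∀ n ∉ Finset.range (p.natDegree + 1), coeff n (p : ℂ⟦X⟧) = 0 := fun n hn => by
    have h : p.natDegree < n := by simpa using hn
    simp [Polynomial.coeff_eq_zero_of_natDegree_lt h]
  refine ⟨summable_of_ne_finset_zero (s := Finset.range (p.natDegree + 1)) fun n hn => by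
    rw [hz n hn, norm_zero], fun ζ _ => ?_⟩
  rw [Polynomial.eval_eq_sum_range]
  have := hasSum_sum_of_ne_finset_zero (f := fun n => coeff n (p : ℂ⟦X⟧) * ζ ^ n)
    (s := Finset.range (p.natDegree + 1)) (L := .unconditional ℕ) fun n hn => by
      rw [hz n hn, zero_mul]
  simpa using this

theorem onClosedDisc_C (c : ℂ) : OnClosedDisc (C c) fun _ => c := by
  simpa using onClosedDisc_polynomial (Polynomial.C c)

theorem exists_onClosedDisc_prod {ι : Type*} (s : Finset ι) {F : ι → ℂ → ℂ}
    (h : ∀ i ∈ s, ∃ φ, OnClosedDisc φ (F i)) : ∃ φ, OnClosedDisc φ fun ζ => ∏ i ∈ s, F i ζ := by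
  classical
  induction s using Finset.induction_on with
  | empty => exact ⟨C 1, by simpa using onClosedDisc_C 1⟩
  | insert i s hi ih =>
    obtain ⟨φ, hφ⟩ := h i (Finset.mem_insert_self i s)
    obtain ⟨ψ, hψ⟩ := ih fun j hj => h j (Finset.mem_insert_of_mem hj)
    refine ⟨φ * ψ, ?_⟩
    simpa only [Finset.prod_insert hi] using hφ.mul hψ

theorem continuousOn_tsum_coeff {φ : ℂ⟦X⟧} (hφ : Summable fun n => ‖coeff n φ‖) :
    ContinuousOn (fun ζ => ∑' n, coeff n φ * ζ ^ n) (Metric.closedBall 0 1) := by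
  refine continuousOn_tsum (fun n => by fun_prop) hφ fun n ζ hζ => ?_
  rw [norm_mul, norm_pow]
  exact mul_le_of_le_one_right (norm_nonneg _) (pow_le_one₀ (norm_nonneg _) (by simpa using hζ))

theorem OnClosedDisc.continuousOn {φ : ℂ⟦X⟧} {F : ℂ → ℂ} (h : OnClosedDisc φ F) :
    ContinuousOn F (Metric.closedBall 0 1) :=
  (continuousOn_tsum_coeff h.summable).congr fun ζ hζ =>
    ((h.hasSum ζ (by simpa using hζ)).tsum_eq).symm

/-- Both `F` and the sum of the series are continuous on the closed disc and agree on the dense open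
disc. -/
theorem OnDisc.onClosedDisc {φ : ℂ⟦X⟧} {F : ℂ → ℂ} (h : OnDisc φ F)
    (hφ : Summable fun n => ‖coeff n φ‖) (hF : ContinuousOn F (Metric.closedBall 0 1)) :
    OnClosedDisc φ F := by
  refine ⟨hφ, fun ζ hζ => ?_⟩
  have heq : Set.EqOn F (fun ζ => ∑' n, coeff n φ * ζ ^ n) (Metric.closedBall 0 1) := by
    refine Set.EqOn.of_subset_closure (s := Metric.ball 0 1) (fun ζ hζ => ?_) hF
      (continuousOn_tsum_coeff hφ) Metric.ball_subset_closedBall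
      (by rw [closure_ball _ one_ne_zero])
    exact ((h ζ (by simpa using hζ)).tsum_eq).symm
  rw [heq (by simpa using hζ)]
  refine Summable.hasSum (Summable.of_norm_bounded hφ fun n => ?_)
  rw [norm_mul, norm_pow]
  exact mul_le_of_le_one_right (norm_nonneg _) (pow_le_one₀ (norm_nonneg _) hζ)

/-- By compactness `ν` is analytic on a disc of radius greater than 1, and convergence of its Taylor
series at the point 1 is already absolute. -/
theorem exists_onClosedDisc_of_analyticOnNhd {ν : ℂ → ℂ}
    (hν : AnalyticOnNhd ℂ ν (Metric.closedBall 0 1)) : ∃ φ, OnClosedDisc φ ν := by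
  obtain ⟨U, hsU, hUo, hU⟩ : ∃ U, Metric.closedBall (0 : ℂ) 1 ⊆ U ∧ IsOpen U ∧
      ∀ ζ ∈ U, AnalyticAt ℂ ν ζ :=
    ⟨{ζ | AnalyticAt ℂ ν ζ}, hν, isOpen_analyticAt ℂ ν, fun _ h => h⟩
  obtain ⟨δ, hδ, hδU⟩ := (isCompact_closedBall (0 : ℂ) 1).exists_cthickening_subset_open hUo hsU
  rw [cthickening_closedBall hδ.le zero_le_one] at hδU
  let R : NNReal := ⟨δ + 1, by positivity⟩
  have hR : (1 : ENNReal) < R := by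
    rw [← ENNReal.coe_one, ENNReal.coe_lt_coe, ← NNReal.coe_lt_coe]
    change 1 < δ + 1
    linarith
  have hps := DifferentiableOn.hasFPowerSeriesOnBall (R := R) (c := (0 : ℂ)) (f := ν)
    (fun ζ hζ => (hU ζ (hδU hζ)).differentiableAt.differentiableWithinAt)
    (by rw [← ENNReal.coe_pos]; exact zero_lt_one.trans hR)
  have hsum : ∀ ζ : ℂ, ‖ζ‖ ≤ 1 →
      HasSum (fun n => (cauchyPowerSeries ν 0 R).coeff n * ζ ^ n) (ν ζ) := by
    intro ζ hζ
    have h := hps.hasSum (y := ζ) (by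
      rw [Metric.mem_eball, edist_zero_right]
      refine lt_of_le_of_lt ?_ hR
      rw [← ofReal_norm, ← ENNReal.ofReal_one]
      exact ENNReal.ofReal_le_ofReal hζ)
    simpa [mul_comm] using h
  refine ⟨PowerSeries.mk fun n => (cauchyPowerSeries ν 0 R).coeff n, ?_, fun ζ hζ => ?_⟩
  · simpa using (hsum 1 (by simp)).summable.norm
  · simpa using hsum ζ hζ

/-! ### Binomial series and the factorization of `ω` -/

theorem choose_succ_mul (s : ℂ) (n : ℕ) :
    Ring.choose s (n + 1) * (n + 1) = Ring.choose s n * (s - n) := by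
  have h1 := Ring.descPochhammer_eq_factorial_smul_choose s (n + 1)
  have h2 := Ring.descPochhammer_eq_factorial_smul_choose s n
  rw [descPochhammer_succ_right, Polynomial.smeval_mul, h2] at h1
  simp only [Polynomial.smeval_sub, Polynomial.smeval_X, pow_one, Polynomial.smeval_natCast,
    pow_zero, nsmul_eq_mul, mul_one, Nat.factorial_succ, Nat.cast_mul, Nat.cast_add,
    Nat.cast_one] at h1
  have h3 : ((n.factorial : ℕ) : ℂ) ≠ 0 := by exact_mod_cast n.factorial_ne_zero
  apply mul_left_cancel₀ h3
  linear_combination -h1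

/-- For `Re s > 0` the binomial series of exponent `s` converges absolutely on the unit circle. -/
theorem summable_norm_choose {s : ℂ} (hs : 0 < s.re) : Summable fun n => ‖Ring.choose s n‖ := by
  set b : ℕ → ℝ := fun n => ‖Ring.choose s n‖ with hb
  have hrec : ∀ n : ℕ, b (n + 1) * (n + 1) = b n * ‖s - n‖ := by
    intro n
    have := congrArg norm (choose_succ_mul s n)
    rw [norm_mul, norm_mul] at this
    rw [← this]
    congr 1
    rw [show (n : ℂ) + 1 = ((n + 1 : ℕ) : ℂ) by push_cast; ring, Complex.norm_natCast]
    push_cast; ring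
  have hb0 : ∀ n, 0 ≤ b n := fun n => norm_nonneg _
  -- Here `|s - n|² = n² - 2n Re s + |s|²`, which is at most `(n - Re s / 2)²` as soon as `n Re s ≥
  -- |s|²`.
  have hev : ∀ᶠ n : ℕ in atTop, ‖s - n‖ ≤ n - s.re / 2 := by
    filter_upwards [eventually_ge_atTop ⌈‖s‖ ^ 2 / s.re + s.re⌉₊] with n hn
    have hn' : ‖s‖ ^ 2 / s.re + s.re ≤ n := Nat.ceil_le.1 hn
    have h0 : 0 ≤ ‖s‖ ^ 2 / s.re := by positivity
    have h1 : ‖s‖ ^ 2 ≤ n * s.re := by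
      rw [← div_le_iff₀ hs]
      linarith
    refine abs_le_of_sq_le_sq' ?_ (by linarith) |>.2
    rw [← Complex.normSq_eq_norm_sq, Complex.normSq_apply] at h1 ⊢
    simp only [Complex.sub_re, Complex.natCast_re, Complex.sub_im, Complex.natCast_im, sub_zero]
    nlinarith [sq_nonneg s.re]
  obtain ⟨N, hN⟩ := eventually_atTop.1 hev
  -- The recursion gives `(Re s / 2) bₙ ≤ n bₙ - (n + 1) bₙ₊₁`, whose right-hand side telescopes.
  have htel : ∀ k, ∑ i ∈ Finset.range k, s.re / 2 * b (N + i) ≤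
      N * b N - (N + k : ℕ) * b (N + k) := by
    intro k
    induction k with
    | zero => simp
    | succ k ih =>
      rw [Finset.sum_range_succ]
      have h1 := hrec (N + k)
      have h2 := mul_le_mul_of_nonneg_left (hN (N + k) (by omega)) (hb0 (N + k))
      push_cast at h1 h2 ih ⊢
      rw [← add_assoc N k 1]
      linarith
  rw [← summable_nat_add_iff N]
  have hsum : Summable fun i => s.re / 2 * b (N + i) := by
    refine summable_of_sum_range_le (c := N * b N) (fun i => by positivity) fun k => ?_
    have : (0 : ℝ) ≤ (N + k : ℕ) * b (N + k) := by positivity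
    linarith [htel k]
  have := hsum.mul_left (s.re / 2)⁻¹
  refine this.congr fun i => ?_
  rw [← mul_assoc, inv_mul_cancel₀ (by positivity), one_mul, add_comm N i]

theorem re_one_sub_div_nonneg {ζ ξ : ℂ} (hξ : ‖ξ‖ = 1) (hζ : ‖ζ‖ ≤ 1) : 0 ≤ (1 - ζ / ξ).re := by
  have h : (ζ / ξ).re ≤ 1 := (Complex.re_le_norm _).trans (by rwa [norm_div, hξ, div_one])
  simpa using h

theorem one_sub_div_ne_zero {ζ ξ : ℂ} (hξ : ‖ξ‖ = 1) (h : ζ ≠ ξ) : 1 - ζ / ξ ≠ 0 := by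
  have hξ0 : ξ ≠ 0 := by rintro rfl; simp at hξ
  intro h0
  apply h
  field_simp at h0
  linear_combination -h0

theorem one_sub_div_mem_slitPlane {ζ ξ : ℂ} (hξ : ‖ξ‖ = 1) (hζ : ‖ζ‖ ≤ 1) (h : ζ ≠ ξ) :
    1 - ζ / ξ ∈ Complex.slitPlane := by
  have h1 := re_one_sub_div_nonneg hξ hζ
  rw [Complex.mem_slitPlane_iff]
  by_contra! hc
  exact one_sub_div_ne_zero hξ h (Complex.ext (le_antisymm hc.1 h1) hc.2)

theorem exists_onClosedDisc_cpow {s ξ : ℂ} (hs : 0 < s.re) (hξ : ‖ξ‖ = 1) :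
    ∃ φ, OnClosedDisc φ fun ζ => (1 - ζ / ξ) ^ s := by
  refine ⟨PowerSeries.mk fun n => Ring.choose s n * (-ξ⁻¹) ^ n, OnDisc.onClosedDisc ?_ ?_ ?_⟩
  · intro ζ hζ
    have h := (Complex.one_add_cpow_hasFPowerSeriesOnBall_zero (a := s)).hasSum (y := -(ζ / ξ)) (by
      rw [← ENNReal.ofReal_one, Metric.eball_ofReal]
      simpa [hξ] using hζ)
    simp only [binomialSeries_apply, List.ofFn_const, List.prod_replicate, smul_eq_mul,
      zero_add] at h
    rw [← sub_eq_add_neg] at h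
    suffices hfun : (fun n => coeff n (PowerSeries.mk fun n => Ring.choose s n * (-ξ⁻¹) ^ n) * ζ ^ n) =
        fun n => Ring.choose s n * (-(ζ / ξ)) ^ n  by
      rwa [hfun]
    funext n
    rw [coeff_mk, mul_assoc, ← mul_pow]
    congr 2
    rw [div_eq_mul_inv]
    ring
  · simpa [hξ] using summable_norm_choose hs
  · intro ζ hζ
    have hζ' : ‖ζ‖ ≤ 1 := by simpa using hζ
    refine ContinuousAt.continuousWithinAt ?_
    refine ContinuousAt.comp (f := fun ζ => 1 - ζ / ξ) (g := fun w => w ^ s) ?_ (by fun_prop)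
    exact Complex.continuousAt_cpow_const_of_re_pos (Or.inl (re_one_sub_div_nonneg hξ hζ')) hs

/-- A representation of the generating function of `ω` as a quotient `N / P` of two functions given
by absolutely summable power series, without common zeros in the closed unit disc. -/
structure IsFactorization (ω : ℕ → ℂ) (φ ψ : ℂ⟦X⟧) (P N : ℂ → ℂ) : Prop where
  den : OnClosedDisc φ P
  num : OnClosedDisc ψ N
  onDisc : OnDisc (PowerSeries.mk ω) (genFun ω)
  mul_eq : φ * PowerSeries.mk ω = ψ
  num_ne_zero : ∀ ζ : ℂ, ‖ζ‖ ≤ 1 → P ζ = 0 → N ζ ≠ 0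
  exists_extension : ∀ ζ : ℂ, ‖ζ‖ ≤ 1 → P ζ ≠ 0 → N ζ ≠ 0 →
    ∃ F : ℂ → ℂ, DifferentiableAt ℂ F ζ ∧ ∀ w : ℂ, ‖w‖ < 1 → F w = genFun ω w

/-- Since `Re aⱼ ≠ 0`, each factor can be placed in the numerator or the denominator with an
exponent of positive real part, where its binomial series is absolutely summable. The zeros of `P`
are the `ξⱼ` with `Re aⱼ > 0`; there `ν` and the remaining factors are nonzero because the `ξⱼ` are
distinct. -/
theorem IsWeights.exists_factorization {β : ℝ} {ω : ℕ → ℂ} (h : IsWeights β ω) :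
    ∃ φ ψ P N, IsFactorization ω φ ψ P N ∧ (0 < β → P 1 = 0) ∧ (β < 0 → P 1 ≠ 0 ∧ N 1 = 0) := by
  classical
  obtain ⟨l, ξ, a, ν, hξ0, ha0, hinj, hξ, -, hre, -, hν, hνξ, hsum⟩ := h
  let p : Fin (l + 1) → ℂ → ℂ := fun j ζ => if 0 < (a j).re then (1 - ζ / ξ j) ^ a j else 1
  let q : Fin (l + 1) → ℂ → ℂ := fun j ζ => if 0 < (a j).re then 1 else (1 - ζ / ξ j) ^ (-a j)
  have hp : ∀ j ∈ Finset.univ, ∃ φ, OnClosedDisc φ (p j) := fun j _ => by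
    by_cases hj : 0 < (a j).re
    · simpa only [p, if_pos hj] using exists_onClosedDisc_cpow hj (hξ j)
    · simpa only [p, if_neg hj] using ⟨_, onClosedDisc_C 1⟩
  have hq : ∀ j ∈ Finset.univ, ∃ φ, OnClosedDisc φ (q j) := fun j _ => by
    by_cases hj : 0 < (a j).re
    · simpa only [q, if_pos hj] using ⟨_, onClosedDisc_C 1⟩
    · have hj' : 0 < (-a j).re := by
        rw [Complex.neg_re]
        exact neg_pos.2 (lt_of_le_of_ne (not_lt.1 hj) (hre j))
      simpa only [q, if_neg hj] using exists_onClosedDisc_cpow hj' (hξ j)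
  obtain ⟨φ, hφ⟩ := exists_onClosedDisc_prod _ hp
  obtain ⟨χ, hχ⟩ := exists_onClosedDisc_prod _ hq
  obtain ⟨μ, hμ⟩ := exists_onClosedDisc_of_analyticOnNhd hν
  have hω : OnDisc (PowerSeries.mk ω) fun ζ => ν ζ * ∏ j, (1 - ζ / ξ j) ^ (-a j) :=
    fun ζ hζ => by simpa using hsum ζ hζ
  have hgen : ∀ ζ : ℂ, ‖ζ‖ < 1 → ν ζ * ∏ j, (1 - ζ / ξ j) ^ (-a j) = genFun ω ζ :=
    fun ζ hζ => (hsum ζ hζ).tsum_eq.symm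
  have hne : ∀ (ζ : ℂ) j, ζ ≠ ξ j → ∀ s : ℂ, (1 - ζ / ξ j) ^ s ≠ 0 := fun ζ j hj s h0 =>
    one_sub_div_ne_zero (hξ j) hj ((Complex.cpow_eq_zero_iff _ s).1 h0).1
  have hzero : ∀ j, ∀ s : ℂ, s.re ≠ 0 → (1 - ξ j / ξ j) ^ s = 0 := fun j s hs => by
    have : ξ j ≠ 0 := by
      intro h0
      simpa [h0] using hξ j
    rw [div_self this, sub_self, Complex.zero_cpow]
    rintro rfl
    simp at hs
  have hP : ∀ j, 0 < (a j).re → ∏ i, p i (ξ j) = 0 := fun j hj =>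
    Finset.prod_eq_zero (Finset.mem_univ j) (by simp only [p, if_pos hj]; exact hzero j _ hj.ne')
  have hQ : ∀ j, ¬ 0 < (a j).re → ∏ i, q i (ξ j) = 0 := fun j hj =>
    Finset.prod_eq_zero (Finset.mem_univ j) (by
      simp only [q, if_neg hj]
      exact hzero j _ (by simpa using hre j))
  have hP' : ∀ ζ, ∏ i, p i ζ = 0 → ∃ j, 0 < (a j).re ∧ ζ = ξ j := fun ζ h0 => by
    obtain ⟨j, -, hj⟩ := Finset.prod_eq_zero_iff.1 h0
    by_cases hj' : 0 < (a j).re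
    · refine ⟨j, hj', ?_⟩
      by_contra hc
      simp only [p, if_pos hj'] at hj
      exact hne ζ j hc _ hj
    · simp [p, hj'] at hj
  refine ⟨φ, μ * χ, _, _, ⟨hφ, hμ.mul hχ, hω.congr hgen, ?_, ?_, ?_⟩, ?_, ?_⟩
  · refine (hφ.onDisc.mul hω).unique ((hμ.mul hχ).onDisc.congr fun ζ hζ => ?_)
    rw [mul_left_comm, ← Finset.prod_mul_distrib]
    congr 1
    refine Finset.prod_congr rfl fun j _ => ?_
    have hj : 1 - ζ / ξ j ≠ 0 := by
      refine one_sub_div_ne_zero (hξ j) ?_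
      rintro rfl
      exact hζ.ne (hξ j)
    by_cases hj' : 0 < (a j).re
    · simp only [p, q, if_pos hj', Complex.cpow_neg]
      rw [mul_inv_cancel₀]
      exact fun h0 => hj ((Complex.cpow_eq_zero_iff _ _).1 h0).1
    · simp only [p, q, if_neg hj', one_mul]
  · intro ζ _ h0
    obtain ⟨j, hj, rfl⟩ := hP' ζ h0
    refine mul_ne_zero (hνξ j) (Finset.prod_ne_zero_iff.2 fun i _ => ?_)
    by_cases hi : 0 < (a i).re
    · simp [q, hi]
    · simp only [q, if_neg hi]
      refine hne _ i (fun h => ?_) _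
      rw [hinj h] at hj
      exact hi hj
  · intro ζ hζ hPζ hNζ
    -- Every `ξⱼ` is a zero of `P` or of `N`, so away from these zeros all the principal powers are
    -- differentiable.
    have hζξ : ∀ j, ζ ≠ ξ j := by
      rintro j rfl
      by_cases hj : 0 < (a j).re
      · exact hPζ (hP j hj)
      · exact hNζ (by rw [hQ j hj, mul_zero])
    refine ⟨fun ζ => ν ζ * ∏ j, (1 - ζ / ξ j) ^ (-a j), ?_, hgen⟩
    refine (hν ζ (by simpa using hζ)).differentiableAt.mul ?_
    refine DifferentiableAt.fun_finsetProd fun j _ => ?_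
    exact DifferentiableAt.cpow_const (by fun_prop)
      (one_sub_div_mem_slitPlane (hξ j) hζ (hζξ j))
  · intro hβ
    rw [← hξ0]
    exact hP 0 (by simpa [ha0] using hβ)
  · intro hβ
    have h0 : ¬ 0 < (a 0).re := by simpa [ha0] using hβ.le
    rw [← hξ0]
    refine ⟨fun hc => ?_, by rw [hQ 0 h0, mul_zero]⟩
    obtain ⟨j, hj, hj'⟩ := hP' _ hc
    exact h0 (hinj hj' ▸ hj)

theorem neBot_nhdsWithin_ball {ξ : ℂ} (hξ : ‖ξ‖ ≤ 1) : (𝓝[Metric.ball (0 : ℂ) 1] ξ).NeBot := by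
  rw [← mem_closure_iff_nhdsWithin_neBot, closure_ball _ one_ne_zero]
  simpa using hξ

theorem OnClosedDisc.tendsto {φ : ℂ⟦X⟧} {F : ℂ → ℂ} (h : OnClosedDisc φ F) {ξ : ℂ} (hξ : ‖ξ‖ ≤ 1) :
    Tendsto F (𝓝[Metric.ball 0 1] ξ) (𝓝 (F ξ)) :=
  (h.continuousOn ξ (by simpa using hξ)).mono_left
    (nhdsWithin_mono _ Metric.ball_subset_closedBall)

namespace IsFactorization

variable {ω : ℕ → ℂ} {φ ψ : ℂ⟦X⟧} {P N : ℂ → ℂ}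

theorem den_mul_genFun (h : IsFactorization ω φ ψ P N) {ζ : ℂ} (hζ : ‖ζ‖ < 1) :
    P ζ * genFun ω ζ = N ζ :=
  OnDisc.eqOn (φ := ψ) (by simpa only [h.mul_eq] using h.den.onDisc.mul h.onDisc) h.num.onDisc hζ

theorem tendsto_genFun (h : IsFactorization ω φ ψ P N) {ξ : ℂ} (hξ : ‖ξ‖ ≤ 1) (hP : P ξ ≠ 0) :
    Tendsto (genFun ω) (𝓝[Metric.ball 0 1] ξ) (𝓝 (N ξ / P ξ)) := by
  refine ((h.num.tendsto hξ).div (h.den.tendsto hξ) hP).congr' ?_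
  filter_upwards [self_mem_nhdsWithin, (h.den.tendsto hξ).eventually_ne hP] with ζ hζ hPζ
  rw [Pi.div_apply, ← h.den_mul_genFun (by simpa using hζ), mul_div_cancel_left₀ _ hPζ]

theorem tendsto_inv_genFun (h : IsFactorization ω φ ψ P N) {ξ : ℂ} (hξ : ‖ξ‖ ≤ 1) (hN : N ξ ≠ 0) :
    Tendsto (fun ζ => (genFun ω ζ)⁻¹) (𝓝[Metric.ball 0 1] ξ) (𝓝 (P ξ / N ξ)) := by
  refine ((h.den.tendsto hξ).div (h.num.tendsto hξ) hN).congr' ?_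
  filter_upwards [self_mem_nhdsWithin, (h.num.tendsto hξ).eventually_ne hN] with ζ hζ hNζ
  have h1 := h.den_mul_genFun (ζ := ζ) (by simpa using hζ)
  have h2 : P ζ ≠ 0 := fun h0 => hNζ (by rw [← h1, h0, zero_mul])
  rw [Pi.div_apply, ← h1, div_mul_cancel_left₀ h2]

theorem den_mul_eq_of_tendsto (h : IsFactorization ω φ ψ P N) {ξ w : ℂ} (hξ : ‖ξ‖ ≤ 1)
    (hw : Tendsto (genFun ω) (𝓝[Metric.ball 0 1] ξ) (𝓝 w)) : P ξ * w = N ξ := by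
  have := neBot_nhdsWithin_ball hξ
  refine tendsto_nhds_unique (((h.den.tendsto hξ).mul hw).congr' ?_) (h.num.tendsto hξ)
  filter_upwards [self_mem_nhdsWithin] with ζ hζ
  exact h.den_mul_genFun (by simpa using hζ)

/-- A zero of `P` is a pole of `ω`: a finite limit there would force a common zero of `P` and `N`.
-/
theorem den_ne_zero_of_tendsto (h : IsFactorization ω φ ψ P N) {ξ w : ℂ} (hξ : ‖ξ‖ ≤ 1)
    (hw : Tendsto (genFun ω) (𝓝[Metric.ball 0 1] ξ) (𝓝 w)) : P ξ ≠ 0 := fun h0 =>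
  h.num_ne_zero ξ hξ h0 (by rw [← h.den_mul_eq_of_tendsto hξ hw, h0, zero_mul])

end IsFactorization

/-! ### Radial growth of generating functions -/

/-- Near its singularity at `1`, the generating function of weights of order `-α` is
`O((1 - r)^α)`. -/
theorem IsWeights.exists_norm_genFun_le {α : ℝ} {ω : ℕ → ℂ} (h : IsWeights (-α) ω) :
    ∃ K : ℝ, ∀ᶠ r : ℝ in 𝓝[<] 1, ‖genFun ω r‖ ≤ K * (1 - r) ^ α := by
  obtain ⟨l, ξ, a, ν, hξ0, ha0, hinj, hξ, -, -, -, hν, -, hsum⟩ := h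
  -- `H` is `ω` without its factor at `1`; it is continuous there, and the omitted factor has
  -- modulus `(1 - r)^α`.
  let H : ℂ → ℂ := fun ζ => ν ζ * ∏ j : Fin l, (1 - ζ / ξ j.succ) ^ (-a j.succ)
  have hH : ContinuousAt H 1 := by
    refine (hν 1 (by simp)).continuousAt.mul ?_
    refine tendsto_finsetProd _ fun j _ => ?_
    have hj : (1 : ℂ) ≠ ξ j.succ := by
      rw [← hξ0]
      exact fun hc => (Fin.succ_ne_zero j) (hinj hc).symm
    have hd : DifferentiableAt ℂ (fun ζ : ℂ => (1 - ζ / ξ j.succ) ^ (-a j.succ)) 1 :=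
      DifferentiableAt.cpow_const (by fun_prop)
        (one_sub_div_mem_slitPlane (hξ _) (by simp) hj)
    exact hd.continuousAt
  have hr : Tendsto (fun r : ℝ => ‖H r‖) (𝓝[<] 1) (𝓝 ‖H 1‖) := by
    have h1 : Tendsto (fun r : ℝ => (r : ℂ)) (𝓝[<] 1) (𝓝 1) := by
      have := (Complex.continuous_ofReal.tendsto 1).mono_left (nhdsWithin_le_nhds (s := Set.Iio 1))
      simpa using this
    exact (hH.tendsto.comp h1).norm
  refine ⟨‖H 1‖ + 1, ?_⟩
  have h0 : ∀ᶠ r : ℝ in 𝓝[<] 1, 0 < r :=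
    (lt_mem_nhds zero_lt_one).filter_mono nhdsWithin_le_nhds
  filter_upwards [hr.eventually_le_const (lt_add_one _), h0, self_mem_nhdsWithin] with r h1 h2 h3
  have h3' : 0 < 1 - r := sub_pos.2 h3
  have hr1 : ‖(r : ℂ)‖ < 1 := by
    rw [Complex.norm_real, Real.norm_of_nonneg h2.le]
    exact h3
  have hgen : genFun ω r = _ := (hsum r hr1).tsum_eq
  rw [hgen, Fin.prod_univ_succ, hξ0, ha0, mul_left_comm, norm_mul, mul_comm]
  refine mul_le_mul h1 (le_of_eq ?_) (norm_nonneg _) (by positivity)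
  rw [show (1 : ℂ) - (r : ℂ) / 1 = ((1 - r : ℝ) : ℂ) by push_cast; ring,
    Complex.norm_cpow_eq_rpow_re_of_pos h3']
  simp

theorem onDisc_genFun {y : ℕ → ℂ} (hy : Tendsto y atTop (𝓝 0)) :
    OnDisc (PowerSeries.mk y) (genFun y) := by
  intro ζ hζ
  obtain ⟨B, hB⟩ := hy.norm.bddAbove_range
  have hs : Summable fun n => y n * ζ ^ n := by
    refine Summable.of_norm_bounded
      ((summable_geometric_of_lt_one (norm_nonneg ζ) hζ).mul_left B) fun n => ?_
    rw [norm_mul, norm_pow]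
    exact mul_le_mul_of_nonneg_right (hB ⟨n, rfl⟩) (by positivity)
  simpa [genFun] using hs.hasSum

/-- The generating function of a null sequence is `o(1 / (1 - r))` along every radius. -/
theorem tendsto_one_sub_mul_genFun {y : ℕ → ℂ} (hy : Tendsto y atTop (𝓝 0)) {ξ : ℂ}
    (hξ : ‖ξ‖ = 1) :
    Tendsto (fun r : ℝ => ((1 - r : ℝ) : ℂ) * genFun y (r * ξ)) (𝓝[<] 1) (𝓝 0) := by
  rw [Metric.tendsto_nhds]
  intro ε hε
  -- Abelian splitting: the terms before `N` contribute at most `B`, the tail at most `(ε / 2) / (1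
  -- - r)`.
  obtain ⟨N, hN⟩ := eventually_atTop.1 ((Metric.tendsto_nhds.1 hy) (ε / 2) (by positivity))
  set B : ℝ := ∑ n ∈ Finset.range N, ‖y n‖ with hB
  have hlim : Tendsto (fun r : ℝ => (1 - r) * B + ε / 2) (𝓝[<] 1) (𝓝 (ε / 2)) := by
    have : Continuous fun r : ℝ => (1 - r) * B + ε / 2 := by fun_prop
    simpa using (this.tendsto 1).mono_left (nhdsWithin_le_nhds (s := Set.Iio 1))
  have h0 : ∀ᶠ r : ℝ in 𝓝[<] 1, 0 < r :=
    (lt_mem_nhds zero_lt_one).filter_mono nhdsWithin_le_nhds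
  filter_upwards [hlim.eventually_lt_const (half_lt_self hε), h0, self_mem_nhdsWithin]
    with r hr hr0 hr1
  have hr1' : r < 1 := hr1
  have hr1'' : 0 < 1 - r := sub_pos.2 hr1'
  have hsum1 : HasSum (fun n => if n < N then ‖y n‖ else 0) B := by
    have h := hasSum_sum_of_ne_finset_zero (f := fun n => if n < N then ‖y n‖ else 0)
      (s := Finset.range N) (L := .unconditional ℕ) fun n hn => if_neg (by simpa using hn)
    convert! h using 1
    exact Finset.sum_congr rfl fun n hn => (if_pos (by simpa using hn)).symm
  have hsum := hsum1.add ((hasSum_geometric_of_lt_one hr0.le hr1').mul_left (ε / 2))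
  have hle : ‖genFun y (r * ξ)‖ ≤ B + ε / 2 * (1 - r)⁻¹ := by
    refine tsum_of_norm_bounded hsum fun n => ?_
    rw [norm_mul, norm_pow, norm_mul, hξ, mul_one, Complex.norm_real, Real.norm_of_nonneg hr0.le]
    have hrn : 0 ≤ r ^ n := by positivity
    split_ifs with h
    · have : r ^ n ≤ 1 := pow_le_one₀ hr0.le hr1'.le
      nlinarith [norm_nonneg (y n)]
    · have := hN n (not_lt.1 h)
      rw [dist_zero_right] at this
      nlinarith
  rw [dist_zero_right, norm_mul, Complex.norm_real, Real.norm_of_nonneg hr1''.le]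
  calc (1 - r) * ‖genFun y (r * ξ)‖ ≤ (1 - r) * (B + ε / 2 * (1 - r)⁻¹) := by gcongr
    _ = (1 - r) * B + ε / 2 := by field_simp
    _ < ε := hr

/-! ### Stability of convolution equations -/

/-- All solutions of the convolution equations `∑ₖ d_{n-k} yₖ = cₙ y₀`, `n ≥ m`, with admissible
`m` and given starting values exist and tend to zero. -/
def IsStable (D : ℂ⟦X⟧) (c : ℕ → ℂ) (M : ℕ → Prop) : Prop :=
  ∀ m, 1 ≤ m → M m → ∀ s : Fin m → ℂ,
    (∃ y : ℕ → ℂ, (∀ k : Fin m, y k = s k) ∧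
      ∀ n, m ≤ n → coeff n (D * PowerSeries.mk y) = y 0 * c n) ∧
    ∀ y : ℕ → ℂ, (∀ k : Fin m, y k = s k) →
      (∀ n, m ≤ n → coeff n (D * PowerSeries.mk y) = y 0 * c n) → Tendsto y atTop (𝓝 0)

theorem coeff_mul_congr {D y y' : ℂ⟦X⟧} {n : ℕ} (h : ∀ k ≤ n, coeff k y = coeff k y') :
    coeff n (D * y) = coeff n (D * y') := by
  rw [coeff_mul, coeff_mul]
  refine Finset.sum_congr rfl fun kl hkl => ?_
  have := Finset.HasAntidiagonal.mem_antidiagonal.1 hkl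
  rw [h kl.2 (by omega)]

theorem coeff_eq_of_coeff_mul {D y y' : ℂ⟦X⟧} (hD : constantCoeff D ≠ 0) {m : ℕ}
    (h : ∀ k < m, coeff k (D * y) = coeff k (D * y')) : ∀ k < m, coeff k y = coeff k y' := by
  intro k hk
  have h1 : ∀ z : ℂ⟦X⟧, z = D⁻¹ * (D * z) := fun z => by
    rw [← mul_assoc, PowerSeries.inv_mul_cancel D hD, one_mul]
  rw [h1 y, h1 y']
  exact coeff_mul_congr fun j hj => h j (hj.trans_lt hk)

theorem exists_solution {D : ℂ⟦X⟧} (hD : constantCoeff D ≠ 0) (c : ℕ → ℂ) {m : ℕ} (hm : 1 ≤ m)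
    (s : Fin m → ℂ) : ∃ y : ℕ → ℂ, (∀ k : Fin m, y k = s k) ∧
      ∀ n, m ≤ n → coeff n (D * PowerSeries.mk y) = y 0 * c n := by
  let t : ℂ⟦X⟧ := PowerSeries.mk fun k => if h : k < m then s ⟨k, h⟩ else 0
  -- The solution is `D⁻¹ f`: below `m` the right-hand side is whatever the starting values produce,
  -- from `m` on it is the prescribed one.
  let f : ℂ⟦X⟧ := PowerSeries.mk fun n => if n < m then coeff n (D * t) else s ⟨0, hm⟩ * c n
  have hDf : D * (D⁻¹ * f) = f := by
    rw [← mul_assoc, PowerSeries.mul_inv_cancel D hD, one_mul]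
  have hmk : PowerSeries.mk (fun n => coeff n (D⁻¹ * f)) = D⁻¹ * f := by
    ext n
    simp
  have hy : ∀ k : Fin m, coeff (k : ℕ) (D⁻¹ * f) = s k := fun k => by
    have := coeff_eq_of_coeff_mul hD (y := D⁻¹ * f) (y' := t) (m := m) (fun k hk => by
      rw [hDf, coeff_mk, if_pos hk]) k k.2
    rw [this, coeff_mk, dif_pos k.2]
  refine ⟨fun n => coeff n (D⁻¹ * f), hy, fun n hn => ?_⟩
  have h0 : coeff 0 (D⁻¹ * f) = s ⟨0, hm⟩ := hy ⟨0, hm⟩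
  simp only [hmk, hDf, h0]
  rw [coeff_mk, if_neg (not_lt.2 hn)]

/-- Multiplying by `φ` makes the operator absolutely summable while the right-hand side stays null;
Wiener's lemma then removes `Q`. -/
theorem isStable_of_ne_zero {D φ Q : ℂ⟦X⟧} {G : ℂ → ℂ} {c : ℕ → ℂ} (M : ℕ → Prop)
    (hD : constantCoeff D ≠ 0) (hc : Tendsto c atTop (𝓝 0))
    (hφ : Summable fun n => ‖coeff n φ‖) (hQ : φ * D = Q) (hG : OnClosedDisc Q G)
    (h0 : ∀ ζ : ℂ, ‖ζ‖ ≤ 1 → G ζ ≠ 0) : IsStable D c M := by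
  refine fun m hm _ s => ⟨exists_solution hD c hm s, fun y _ hy => ?_⟩
  have h1 : Tendsto (fun n => coeff n (D * PowerSeries.mk y)) atTop (𝓝 0) := by
    have h2 : Tendsto (fun n => y 0 * c n) atTop (𝓝 0) := by simpa using hc.const_mul (y 0)
    refine h2.congr' ?_
    filter_upwards [eventually_ge_atTop m] with n hn
    exact (hy n hn).symm
  have h2 := tendsto_coeff_mul hφ h1
  rw [← mul_assoc, hQ] at h2
  simpa using tendsto_coeff_of_mul hG.summable
    (fun ζ hζ => by rw [(hG.hasSum ζ hζ).tsum_eq]; exact h0 ζ hζ) h2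

/-- With `d₀ = 0` the equation of index `m` does not involve `y m`, so it constrains the starting
values. A unit impulse at `m - j`, where `dⱼ ≠ 0`, violates it, as its left-hand side is `dⱼ` and `y
0 = 0`. -/
theorem not_isStable_of_constantCoeff {D : ℂ⟦X⟧} {c : ℕ → ℂ} {M : ℕ → Prop}
    (hM : ∀ᶠ m in atTop, M m) (hD0 : constantCoeff D = 0) (hD : D ≠ 0) : ¬ IsStable D c M := by
  intro hS
  obtain ⟨j, hj⟩ : ∃ j, coeff j D ≠ 0 := by
    by_contra! hc
    exact hD (PowerSeries.ext hc)
  have hj0 : j ≠ 0 := by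
    rintro rfl
    exact hj (by simpa using hD0)
  obtain ⟨m, hm, hjm⟩ := (hM.and (eventually_gt_atTop j)).exists
  obtain ⟨⟨y, hys, hy⟩, -⟩ := hS m (by omega) hm fun k => if (k : ℕ) = m - j then 1 else 0
  have hy0 : y 0 = 0 := by
    rw [hys ⟨0, by omega⟩]
    exact if_neg (by simp only; omega)
  have h1 := hy m le_rfl
  rw [hy0, zero_mul, coeff_mul] at h1
  rw [Finset.sum_eq_single (j, m - j)] at h1
  · rw [coeff_mk, hys ⟨m - j, by omega⟩] at h1
    simp at h1
    exact hj h1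
  · rintro ⟨i, k⟩ hik hne
    have hik' : i + k = m := Finset.HasAntidiagonal.mem_antidiagonal.1 hik
    by_cases hi : i = 0
    · subst hi
      simp [hD0]
    · rw [coeff_mk, hys ⟨k, by omega⟩, if_neg, mul_zero]
      simp only
      rintro rfl
      exact hne (by rw [Prod.mk.injEq]; omega)
  · intro h
    exact absurd (Finset.HasAntidiagonal.mem_antidiagonal.2 (by simp only; omega)) h

/-- A null sequence `y` cannot solve `D y = X` if `D` has a zero in the closed unit disc, away from
the origin, at which it is differentiable. -/
theorem mul_mk_ne_X {D : ℂ⟦X⟧} {G : ℂ → ℂ} {ξ : ℂ} {y : ℕ → ℂ} (hG : OnDisc D G) (hξ : ‖ξ‖ ≤ 1)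
    (hξ0 : ξ ≠ 0) (hd : DifferentiableAt ℂ G ξ) (hGξ : G ξ = 0) (hy : Tendsto y atTop (𝓝 0)) :
    D * PowerSeries.mk y ≠ X := by
  intro hX
  have hmul : ∀ ζ : ℂ, ‖ζ‖ < 1 → G ζ * genFun y ζ = ζ := fun ζ hζ => by
    have h1 := hG.mul (onDisc_genFun hy)
    have h2 := (onClosedDisc_polynomial Polynomial.X).onDisc
    rw [hX] at h1
    rw [Polynomial.coe_X] at h2
    simpa using h1.eqOn h2 hζ
  rcases hξ.lt_or_eq with hlt | heq
  · exact hξ0 (by rw [← hmul ξ hlt, hGξ, zero_mul])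
  · have hr : Tendsto (fun r : ℝ => (r : ℂ) * ξ) (𝓝[<] 1) (𝓝 ξ) := by
      have : Continuous fun r : ℝ => (r : ℂ) * ξ := by fun_prop
      simpa using (this.tendsto 1).mono_left (nhdsWithin_le_nhds (s := Set.Iio 1))
    -- Differentiability at the zero `ξ` gives `G = O(1 - r)`, so its product with the `o(1 / (1 -
    -- r))` of `y` tends to 0 instead of `ξ`.
    have hO : (fun r : ℝ => G (r * ξ)) =O[𝓝[<] 1] fun r : ℝ => ((1 - r : ℝ) : ℂ) := by
      have h1 := hd.isBigO_sub.comp_tendsto hr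
      refine (h1.congr_left fun r => by simp [hGξ]).trans ?_
      refine Asymptotics.IsBigO.of_bound 1 (Eventually.of_forall fun r => ?_)
      have : (r : ℂ) * ξ - ξ = -(((1 - r : ℝ) : ℂ) * ξ) := by push_cast; ring
      simp only [Function.comp_apply]
      rw [this, norm_neg, norm_mul, heq, mul_one, one_mul]
    have h2 := (hO.mul (Asymptotics.isBigO_refl (fun r : ℝ => genFun y (r * ξ)) _)).trans_tendsto
      (tendsto_one_sub_mul_genFun hy heq)
    refine hξ0 (tendsto_nhds_unique (hr.congr' ?_) h2)
    have h0 : ∀ᶠ r : ℝ in 𝓝[<] 1, 0 < r :=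
      (lt_mem_nhds zero_lt_one).filter_mono nhdsWithin_le_nhds
    filter_upwards [h0, self_mem_nhdsWithin] with r hr0 hr1
    refine (hmul _ ?_).symm
    rw [norm_mul, heq, mul_one, Complex.norm_real, Real.norm_of_nonneg hr0.le]
    exact hr1

theorem not_isStable_of_zero {D : ℂ⟦X⟧} {G : ℂ → ℂ} {ξ : ℂ} {c : ℕ → ℂ} {M : ℕ → Prop}
    (hM : ∀ᶠ m in atTop, M m) (hD : D ≠ 0) (hG : OnDisc D G) (hξ : ‖ξ‖ ≤ 1)
    (hd : DifferentiableAt ℂ G ξ) (hGξ : G ξ = 0) : ¬ IsStable D c M := by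
  by_cases hD0 : constantCoeff D = 0
  · exact not_isStable_of_constantCoeff hM hD0 hD
  intro hS
  have hG0 : G 0 = constantCoeff D := by
    have h1 := (hG 0 (by simp)).tsum_eq
    rw [← h1, tsum_eq_single 0 fun n hn => by simp [hn]]
    simp
  have hξ0 : ξ ≠ 0 := by
    rintro rfl
    exact hD0 (hG0 ▸ hGξ)
  -- With `m ≥ 2` the only nonzero coefficient of `X` lies below `m`. The starting values of `D⁻¹ X`
  -- have `y 0 = 0`, which switches off the source, so the solution satisfies `D · Y = X`.
  obtain ⟨m, hm, hm2⟩ := (hM.and (eventually_ge_atTop 2)).exists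
  obtain ⟨⟨y, hys, hy⟩, hlim⟩ := hS m (by omega) hm fun k => coeff (k : ℕ) (D⁻¹ * X)
  have hy0 : y 0 = 0 := by
    rw [hys ⟨0, by omega⟩]
    simp
  refine mul_mk_ne_X hG hξ hξ0 hd hGξ (hlim y hys hy) (PowerSeries.ext fun n => ?_)
  rcases lt_or_ge n m with hn | hn
  · rw [coeff_mul_congr (y' := D⁻¹ * X) fun k hk => ?_, ← mul_assoc,
      PowerSeries.mul_inv_cancel D hD0, one_mul]
    rw [coeff_mk]
    exact hys ⟨k, by omega⟩
  · rw [hy n hn, hy0, zero_mul, coeff_X, if_neg (by omega)]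

/-! ### The symbol of the two schemes -/

theorem shiftCoeff_of_le (θ : ℝ) {p j : ℕ} (h : p ≤ j) : shiftCoeff θ p j = 0 := by
  rw [shiftCoeff, shiftPoly, Polynomial.finsetSum_coeff]
  refine Finset.sum_eq_zero fun i hi => Polynomial.coeff_eq_zero_of_natDegree_lt ?_
  have hi' : i < p := by simpa using hi
  refine lt_of_le_of_lt ?_ (hi'.trans_le h)
  refine (Polynomial.natDegree_C_mul_le _ _).trans ?_
  refine Polynomial.natDegree_pow_le.trans ?_
  have : (1 - Polynomial.X : Polynomial ℂ).natDegree ≤ 1 :=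
    (Polynomial.natDegree_sub_le _ _).trans (by simp)
  exact (Nat.mul_le_mul_left i this).trans (by simp)

theorem sum_shiftCoeff (θ : ℝ) (p : ℕ) (ζ : ℂ) :
    ∑ j ∈ Finset.range p, shiftCoeff θ p j * ζ ^ j = (shiftPoly θ p).eval ζ := by
  rw [Polynomial.eval_eq_sum_range' (n := max p ((shiftPoly θ p).natDegree + 1))
    (lt_of_lt_of_le (Nat.lt_succ_self _) (le_max_right _ _))]
  refine Finset.sum_subset (by simp) fun j _ hj => ?_
  rw [shiftCoeff_of_le θ (by simpa using hj), zero_mul]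

theorem eval_one_shiftPoly (θ : ℝ) {p : ℕ} (hp : 1 ≤ p) : (shiftPoly θ p).eval 1 = 1 := by
  rw [shiftPoly, Polynomial.eval_finsetSum, Finset.sum_eq_single 0]
  · simp
  · intro i _ hi
    simp [hi]
  · intro h
    exact absurd (Finset.mem_range.2 hp) h

/-- The generating series `u ω(ξ) + v Θ(ξ)` of a linear combination of the two convolutions. -/
noncomputable def symbol (θ : ℝ) (p : ℕ) (ω : ℕ → ℂ) (u v : ℂ) : ℂ⟦X⟧ :=
  C u * PowerSeries.mk ω + C v * (shiftPoly θ p : ℂ⟦X⟧)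

/-- The condition `p ≤ n + 1` ensures `j ≤ n` for all `j < p`, so the subtraction `n - j` is never
truncated. -/
theorem coeff_symbol_mul (θ : ℝ) {p n : ℕ} (hn : p ≤ n + 1) (ω : ℕ → ℂ) (u v : ℂ) (y : ℕ → ℂ) :
    coeff n (symbol θ p ω u v * PowerSeries.mk y) =
      u * ∑ k ∈ Finset.range (n + 1), ω (n - k) * y k +
        v * ∑ j ∈ Finset.range p, shiftCoeff θ p j * y (n - j) := by
  rw [symbol, add_mul, mul_assoc, mul_assoc, map_add, coeff_C_mul, coeff_C_mul]
  congr 2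
  · rw [mul_comm, coeff_mul, Finset.Nat.sum_antidiagonal_eq_sum_range_succ
      (fun i j => coeff i (PowerSeries.mk y) * coeff j (PowerSeries.mk ω))]
    simp only [coeff_mk, mul_comm]
  · rw [coeff_mul, Finset.Nat.sum_antidiagonal_eq_sum_range_succ
      (fun i j => coeff i (shiftPoly θ p : ℂ⟦X⟧) * coeff j (PowerSeries.mk y))]
    simp only [coeff_mk, Polynomial.coeff_coe]
    refine (Finset.sum_subset (by simpa using hn) fun j _ hj => ?_).symm
    rw [← shiftCoeff, shiftCoeff_of_le θ (by simpa using hj), zero_mul]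

theorem source_eq_mul (α θ : ℝ) (y₀ : ℂ) (n : ℕ) : source α θ y₀ n = y₀ * source α θ 1 n := by
  rw [source, source, one_div, div_eq_mul_inv]

theorem tendsto_source {α : ℝ} (θ : ℝ) (hα0 : 0 < α) (hα1 : α < 1) :
    Tendsto (source α θ 1) atTop (𝓝 0) := by
  have h1 : Tendsto (fun n : ℕ => ((n : ℝ) - θ) ^ α * Real.Gamma (1 - α)) atTop atTop :=
    ((tendsto_rpow_atTop hα0).comp
      (tendsto_atTop_add_const_right _ (-θ) tendsto_natCast_atTop_atTop)).atTop_mul_const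
      (Real.Gamma_pos_of_pos (sub_pos.2 hα1))
  have h2 := (Complex.continuous_ofReal.tendsto 0).comp h1.inv_tendsto_atTop
  rw [Complex.ofReal_zero] at h2
  refine h2.congr fun n => ?_
  simp [source]

/-- The step size `h = 1` already realizes every `z`, so `λ` and `h` matter only through `z`. -/
theorem exists_eq_mul_rpow (α : ℝ) (z : ℂ) :
    ∃ (lam : ℂ) (h : ℝ), 0 < h ∧ z = lam * ((h ^ α : ℝ) : ℂ) :=
  ⟨z, 1, one_pos, by simp⟩

theorem mem_stabilityRegionI {α θ : ℝ} {p : ℕ} {ω : ℕ → ℂ} {z : ℂ} :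
    z ∈ stabilityRegionI α θ p ω ↔
      IsStable (symbol θ p ω 1 (-z)) (source α θ 1) fun m => p ≤ m + 1 ∧ θ < m := by
  have key : ∀ m, p ≤ m + 1 → ∀ y : ℕ → ℂ, SolvesI α θ p ω z m y ↔ ∀ n, m ≤ n →
      coeff n (symbol θ p ω 1 (-z) * PowerSeries.mk y) = y 0 * source α θ 1 n := by
    intro m hm y
    refine forall_congr' fun n => forall_congr' fun hn => ?_
    rw [coeff_symbol_mul θ (by omega), source_eq_mul α θ (y 0), one_mul, neg_mul,
      ← sub_eq_add_neg, sub_eq_iff_eq_add']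
  constructor
  · rintro ⟨-, -, -, -, h⟩ m hm ⟨hpm, hθ⟩ s
    simpa only [key m hpm] using h m hm hpm hθ s
  · intro h
    obtain ⟨lam, x, hx, hz⟩ := exists_eq_mul_rpow α z
    refine ⟨lam, x, hx, hz, fun m hm hpm hθ s => ?_⟩
    simpa only [key m hpm] using h m hm ⟨hpm, hθ⟩ s

theorem mem_stabilityRegionII {α θ : ℝ} {p : ℕ} {ω : ℕ → ℂ} {z : ℂ} :
    z ∈ stabilityRegionII α θ p ω ↔
      z ≠ 0 ∧ IsStable (symbol θ p ω z (-1)) 0 fun m => p ≤ m + 1 := by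
  have key : ∀ m, p ≤ m + 1 → ∀ y : ℕ → ℂ, SolvesII θ p ω z m y ↔ ∀ n, m ≤ n →
      coeff n (symbol θ p ω z (-1) * PowerSeries.mk y) = y 0 * (0 : ℕ → ℂ) n := by
    intro m hm y
    refine forall_congr' fun n => forall_congr' fun hn => ?_
    rw [coeff_symbol_mul θ (by omega), Pi.zero_apply, mul_zero, neg_one_mul,
      ← sub_eq_add_neg, sub_eq_zero]
  constructor
  · rintro ⟨lam, x, hlam, hx, rfl, h⟩
    refine ⟨mul_ne_zero hlam (by exact_mod_cast (Real.rpow_pos_of_pos hx α).ne'),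
      fun m hm hpm s => ?_⟩
    simpa only [key m hpm] using h m hm hpm s
  · rintro ⟨hz0, h⟩
    obtain ⟨lam, x, hx, hz⟩ := exists_eq_mul_rpow α z
    refine ⟨lam, x, ?_, hx, hz, fun m hm hpm s => ?_⟩
    · rintro rfl
      exact hz0 (by simpa using hz)
    · simpa only [key m hpm] using h m hm hpm s

theorem IsFactorization.onDisc_symbol {ω : ℕ → ℂ} {φ ψ : ℂ⟦X⟧} {P N : ℂ → ℂ}
    (h : IsFactorization ω φ ψ P N) (θ : ℝ) (p : ℕ) (u v : ℂ) :
    OnDisc (symbol θ p ω u v) fun ζ => u * genFun ω ζ + v * (shiftPoly θ p).eval ζ :=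
  ((onClosedDisc_C u).onDisc.mul h.onDisc).add
    ((onClosedDisc_C v).mul (onClosedDisc_polynomial (shiftPoly θ p))).onDisc

theorem tendsto_eval (q : Polynomial ℂ) (ξ : ℂ) :
    Tendsto (fun ζ => q.eval ζ) (𝓝[Metric.ball 0 1] ξ) (𝓝 (q.eval ξ)) :=
  (q.continuous.tendsto ξ).mono_left nhdsWithin_le_nhds

theorem isStable_symbol {ω : ℕ → ℂ} {φ ψ : ℂ⟦X⟧} {P N : ℂ → ℂ}
    (h : IsFactorization ω φ ψ P N) {θ : ℝ} {p : ℕ} {u v : ℂ} {c : ℕ → ℂ} (M : ℕ → Prop)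
    (hu : u ≠ 0) (hc : Tendsto c atTop (𝓝 0))
    (h0 : ∀ ξ w : ℂ, ‖ξ‖ ≤ 1 → Tendsto (genFun ω) (𝓝[Metric.ball 0 1] ξ) (𝓝 w) →
      u * w + v * (shiftPoly θ p).eval ξ ≠ 0) : IsStable (symbol θ p ω u v) c M := by
  have hQ : OnClosedDisc (C u * ψ + φ * (C v * (shiftPoly θ p : ℂ⟦X⟧)))
      fun ζ => u * N ζ + P ζ * (v * (shiftPoly θ p).eval ζ) :=
    ((onClosedDisc_C u).mul h.num).add
      (h.den.mul ((onClosedDisc_C v).mul (onClosedDisc_polynomial (shiftPoly θ p))))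
  have hne : ∀ ζ : ℂ, ‖ζ‖ ≤ 1 → u * N ζ + P ζ * (v * (shiftPoly θ p).eval ζ) ≠ 0 := by
    intro ζ hζ
    -- At a pole of `ω` the value is `u * N ζ`, which is nonzero; elsewhere it is `P ζ` times the
    -- value of the symbol.
    by_cases hP : P ζ = 0
    · rw [hP, zero_mul, add_zero]
      exact mul_ne_zero hu (h.num_ne_zero ζ hζ hP)
    · have h1 := mul_ne_zero hP (h0 ζ _ hζ (h.tendsto_genFun hζ hP))
      convert! h1 using 1
      field_simp
  have hmul : φ * symbol θ p ω u v = C u * ψ + φ * (C v * (shiftPoly θ p : ℂ⟦X⟧)) := by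
    rw [symbol, mul_add, mul_left_comm, h.mul_eq]
  refine isStable_of_ne_zero M (fun hD => ?_) hc h.den.summable hmul hQ hne
  refine hne 0 (by simp) ?_
  have h1 := (hQ.hasSum 0 (by simp)).tsum_eq
  rw [tsum_eq_single 0 fun n hn => by simp [hn], ← hmul] at h1
  rw [← h1]
  simp [hD]

/-- The condition `w ≠ 0` keeps `ξ` away from the singularities of `ω` with limit zero, where
differentiability may fail. -/
theorem not_isStable_symbol {ω : ℕ → ℂ} {φ ψ : ℂ⟦X⟧} {P N : ℂ → ℂ}
    (h : IsFactorization ω φ ψ P N) {θ : ℝ} {p : ℕ} {u v ξ w : ℂ} {c : ℕ → ℂ} {M : ℕ → Prop}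
    (hM : ∀ᶠ m in atTop, M m) (hD : symbol θ p ω u v ≠ 0) (hξ : ‖ξ‖ ≤ 1)
    (hw : Tendsto (genFun ω) (𝓝[Metric.ball 0 1] ξ) (𝓝 w)) (hw0 : w ≠ 0)
    (h0 : u * w + v * (shiftPoly θ p).eval ξ = 0) : ¬ IsStable (symbol θ p ω u v) c M := by
  have hP := h.den_ne_zero_of_tendsto hξ hw
  have hN : N ξ ≠ 0 := by
    rw [← h.den_mul_eq_of_tendsto hξ hw]
    exact mul_ne_zero hP hw0
  obtain ⟨F, hF, hFω⟩ := h.exists_extension ξ hξ hP hN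
  have hFξ : F ξ = w := by
    have := neBot_nhdsWithin_ball hξ
    refine tendsto_nhds_unique
      ((hF.continuousAt.tendsto.mono_left nhdsWithin_le_nhds).congr' ?_) hw
    filter_upwards [self_mem_nhdsWithin] with ζ hζ
    exact hFω ζ (by simpa using hζ)
  refine not_isStable_of_zero (G := fun ζ => u * F ζ + v * (shiftPoly θ p).eval ζ) hM hD
    ((h.onDisc_symbol θ p u v).congr fun ζ hζ => by rw [hFω ζ hζ]) hξ ?_ ?_
  · exact (hF.const_mul u).add ((shiftPoly θ p).differentiable.differentiableAt.const_mul v)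
  · rw [hFξ, h0]

theorem isStable_symbol_iff {ω : ℕ → ℂ} {φ ψ : ℂ⟦X⟧} {P N : ℂ → ℂ}
    (h : IsFactorization ω φ ψ P N) {θ : ℝ} {p : ℕ} (hp : 1 ≤ p) (hcz : NoCommonZero θ p ω)
    (hPN : P 1 = 0 ∨ N 1 = 0) {u v : ℂ} (hu : u ≠ 0) (hv : v ≠ 0) {c : ℕ → ℂ} {M : ℕ → Prop}
    (hM : ∀ᶠ m in atTop, M m) (hc : Tendsto c atTop (𝓝 0)) :
    IsStable (symbol θ p ω u v) c M ↔
      -v / u ∉ closedDiscValues fun ζ => genFun ω ζ / (shiftPoly θ p).eval ζ := by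
  have hκ : -v / u ≠ 0 := div_ne_zero (neg_ne_zero.2 hv) hu
  -- Otherwise `ω` is a nonzero multiple of `Θ`, with a finite nonzero limit at `1` since `Θ(1) =
  -- 1`; but `ω` has a zero or a pole there.
  have hD : symbol θ p ω u v ≠ 0 := by
    intro hD
    have h1 : ∀ ζ : ℂ, ‖ζ‖ < 1 → genFun ω ζ = -v / u * (shiftPoly θ p).eval ζ := fun ζ hζ => by
      have h2 := h.onDisc_symbol θ p u v ζ hζ
      rw [hD] at h2
      simp only [map_zero, zero_mul] at h2
      have h3 := h2.unique hasSum_zero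
      field_simp
      linear_combination h3
    have h2 : Tendsto (genFun ω) (𝓝[Metric.ball 0 1] 1) (𝓝 (-v / u)) := by
      have h3 := (tendsto_eval (shiftPoly θ p) 1).const_mul (-v / u)
      rw [eval_one_shiftPoly θ hp, mul_one] at h3
      refine h3.congr' ?_
      filter_upwards [self_mem_nhdsWithin] with ζ hζ
      exact (h1 ζ (by simpa using hζ)).symm
    have hP := h.den_ne_zero_of_tendsto (by simp) h2
    rcases hPN with h3 | h3
    · exact hP h3
    · rw [← h.den_mul_eq_of_tendsto (by simp) h2] at h3
      exact mul_ne_zero hP hκ h3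
  constructor
  · rintro hS ⟨ξ, hξ, hlim⟩
    have hw : Tendsto (genFun ω) (𝓝[Metric.ball 0 1] ξ)
        (𝓝 (-v / u * (shiftPoly θ p).eval ξ)) := by
      refine (hlim.mul (tendsto_eval (shiftPoly θ p) ξ)).congr' ?_
      filter_upwards [hlim.eventually_ne hκ] with ζ hζ
      exact div_mul_cancel₀ _ (div_ne_zero_iff.1 hζ).2
    -- A finite quotient at a zero of `Θ` would make `ω` vanish there too.
    have hΘ : (shiftPoly θ p).eval ξ ≠ 0 := fun h0 => by
      rw [h0, mul_zero] at hw
      exact hcz ξ hξ hw h0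
    refine not_isStable_symbol h hM hD hξ hw (mul_ne_zero hκ hΘ) ?_ hS
    field_simp
    ring
  · intro hval
    refine isStable_symbol h M hu hc fun ξ w hξ hw h0 => ?_
    have hw' : w = -v / u * (shiftPoly θ p).eval ξ := by
      field_simp
      linear_combination h0
    have hΘ : (shiftPoly θ p).eval ξ ≠ 0 := fun hΘ => by
      rw [hΘ, mul_zero] at hw'
      exact hcz ξ hξ (hw' ▸ hw) hΘ
    refine hval ⟨ξ, hξ, ?_⟩
    have := hw.div (tendsto_eval (shiftPoly θ p) ξ) hΘ
    rwa [hw', mul_div_cancel_right₀ _ hΘ] at this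

/-! ### The point `z = 0` of Scheme-I -/

/-- Lower bound for the generating function of a sequence of order at least `n^(-α)`. -/
theorem le_norm_of_coeff_ge {α κ : ℝ} {f : ℂ⟦X⟧} {F : ℂ → ℂ}
    (hF : OnDisc f F) {m N : ℕ} (hmN : m ≤ N) (hN : 1 ≤ N)
    (h0 : ∀ n, m ≤ n → 0 ≤ (coeff n f).re)
    (hκf : ∀ n, N ≤ n → n < 2 * N → κ * ((N : ℝ) ^ α)⁻¹ ≤ (coeff n f).re) :
    κ / 2 * (N : ℝ) ^ (1 - α) - ∑ n ∈ Finset.range m, ‖coeff n f‖ ≤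
      ‖F ((1 - 1 / (4 * N) : ℝ) : ℂ)‖ := by
  have hN0 : (1 : ℝ) ≤ N := by exact_mod_cast hN
  -- By Bernoulli's inequality this radius keeps `r ^ n ≥ 1 / 2` for all `n < 2N`, so the `N` terms
  -- of the block `[N, 2N)` contribute order `N^(1 - α)`.
  set r : ℝ := 1 - 1 / (4 * N) with hr
  have hd : 1 / (4 * (N : ℝ)) ≤ 1 / 4 := by
    apply one_div_le_one_div_of_le <;> linarith
  have hd0 : 0 < 1 / (4 * (N : ℝ)) := by positivity
  have hr0 : 0 < r := by linarith
  have hr1 : r < 1 := by linarith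
  have hsum := Complex.hasSum_re (hF r (by
    rw [Complex.norm_real, Real.norm_of_nonneg hr0.le]
    exact hr1))
  have hterm : ∀ n, (coeff n f * (r : ℂ) ^ n).re = (coeff n f).re * r ^ n := fun n => by
    rw [← Complex.ofReal_pow, Complex.re_mul_ofReal]
  simp only [hterm] at hsum
  have hdisj : Disjoint (Finset.range m) (Finset.Ico N (2 * N)) := by
    rw [Finset.disjoint_left]
    intro n h1 h2
    have h1' := Finset.mem_range.1 h1
    have h2' := (Finset.mem_Ico.1 h2).1
    omega
  have h1 := sum_le_hasSum (Finset.range m ∪ Finset.Ico N (2 * N)) (fun n hn => by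
    have hmn : m ≤ n := by
      by_contra hc
      exact hn (Finset.mem_union_left _ (Finset.mem_range.2 (not_le.1 hc)))
    exact mul_nonneg (h0 n hmn) (by positivity)) hsum
  rw [Finset.sum_union hdisj] at h1
  have h2 : -∑ n ∈ Finset.range m, ‖coeff n f‖ ≤
      ∑ n ∈ Finset.range m, (coeff n f).re * r ^ n := by
    rw [← Finset.sum_neg_distrib]
    refine Finset.sum_le_sum fun n _ => ?_
    have h3 : |(coeff n f).re * r ^ n| ≤ ‖coeff n f‖ := by
      rw [abs_mul, abs_of_nonneg (by positivity : 0 ≤ r ^ n)]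
      exact (mul_le_of_le_one_right (abs_nonneg _) (pow_le_one₀ hr0.le hr1.le)).trans
        (Complex.abs_re_le_norm _)
    linarith [neg_abs_le ((coeff n f).re * r ^ n)]
  have hpow : ∀ n, n < 2 * N → 1 / 2 ≤ r ^ n := by
    intro n hn
    have hb := one_add_mul_le_pow (a := -(1 / (4 * (N : ℝ)))) (by linarith) n
    rw [← sub_eq_add_neg (1 : ℝ) (1 / (4 * (N : ℝ)))] at hb
    refine le_trans ?_ hb
    have hn' : (n : ℝ) ≤ 2 * N := by exact_mod_cast hn.le
    have : (n : ℝ) * (1 / (4 * N)) ≤ 1 / 2 := by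
      rw [mul_one_div, div_le_iff₀ (by positivity)]
      linarith
    linarith
  have h3 : κ / 2 * (N : ℝ) ^ (1 - α) ≤
      ∑ n ∈ Finset.Ico N (2 * N), (coeff n f).re * r ^ n := by
    have h4 := Finset.card_nsmul_le_sum (Finset.Ico N (2 * N))
      (fun n => (coeff n f).re * r ^ n) (κ * ((N : ℝ) ^ α)⁻¹ * (1 / 2)) fun n hn => by
        obtain ⟨hn1, hn2⟩ := Finset.mem_Ico.1 hn
        exact mul_le_mul (hκf n hn1 hn2) (hpow n hn2) (by norm_num) (h0 n (hmN.trans hn1))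
    refine le_trans (le_of_eq ?_) h4
    rw [Nat.card_Ico, show 2 * N - N = N by omega, nsmul_eq_mul, Real.rpow_sub (by positivity),
      Real.rpow_one]
    ring
  have h5 := Complex.re_le_norm (F (r : ℂ))
  linarith

theorem exists_source_ge {α : ℝ} (θ : ℝ) (hα0 : 0 < α) (hα1 : α < 1) :
    ∃ κ : ℝ, 0 < κ ∧ ∀ᶠ N : ℕ in atTop, ∀ n, N ≤ n → n < 2 * N →
      κ * ((N : ℝ) ^ α)⁻¹ ≤ (source α θ 1 n).re := by
  have hΓ := Real.Gamma_pos_of_pos (sub_pos.2 hα1)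
  -- The 3 comes from `n - θ ≤ 2N + |θ| ≤ 3N`.
  refine ⟨((3 : ℝ) ^ α * Real.Gamma (1 - α))⁻¹, by positivity, ?_⟩
  filter_upwards [eventually_gt_atTop ⌈|θ|⌉₊] with N hN n hn1 hn2
  have hN' : |θ| < N := Nat.lt_of_ceil_lt hN
  have h1 : (N : ℝ) ≤ n := by exact_mod_cast hn1
  have h2 : (n : ℝ) ≤ 2 * N := by exact_mod_cast hn2.le
  have h3 : 0 < (n : ℝ) - θ := by linarith [le_abs_self θ]
  have h4 : (n : ℝ) - θ ≤ 3 * N := by linarith [neg_abs_le θ]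
  rw [source, ← Complex.ofReal_one, ← Complex.ofReal_div, Complex.ofReal_re, ← mul_inv, one_div]
  have h5 : ((n : ℝ) - θ) ^ α ≤ 3 ^ α * (N : ℝ) ^ α := by
    rw [← Real.mul_rpow (by norm_num) (by positivity)]
    exact Real.rpow_le_rpow h3.le h4 hα0.le
  have h6 : 0 < ((n : ℝ) - θ) ^ α := Real.rpow_pos_of_pos h3 α
  refine inv_anti₀ (by positivity) ?_
  calc ((n : ℝ) - θ) ^ α * Real.Gamma (1 - α) ≤ 3 ^ α * (N : ℝ) ^ α * Real.Gamma (1 - α) := by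
        gcongr
    _ = _ := by ring

theorem re_source_nonneg {α θ : ℝ} (hα1 : α < 1) {n : ℕ} (hn : θ < n) :
    0 ≤ (source α θ 1 n).re := by
  have hΓ := Real.Gamma_pos_of_pos (sub_pos.2 hα1)
  have h3 : 0 < (n : ℝ) - θ := by linarith
  rw [source, ← Complex.ofReal_one, ← Complex.ofReal_div, Complex.ofReal_re]
  positivity

/-- The convolution of weights of order `-α` with a null sequence has generating function
`o((1 - r)^(α - 1))`, whereas the source term is of exact order `n^(-α)`. -/
theorem IsWeights.not_isStable {α θ : ℝ} (hα0 : 0 < α) (hα1 : α < 1) {ω : ℕ → ℂ}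
    (hω : IsWeights (-α) ω) {M : ℕ → Prop} (hM : ∀ᶠ m in atTop, M m) :
    ¬ IsStable (PowerSeries.mk ω) (source α θ 1) M := by
  intro hS
  obtain ⟨φ, ψ, P, Q, hfac, -⟩ := hω.exists_factorization
  obtain ⟨m, hm, hm1, hmθ⟩ :=
    (hM.and ((eventually_ge_atTop 1).and (eventually_gt_atTop ⌈θ⌉₊))).exists
  have hmθ' : θ < m := Nat.lt_of_ceil_lt hmθ
  -- Any starting values with `y 0 = 1` would do: the source must be switched on.
  obtain ⟨⟨y, hys, hy⟩, hlim⟩ := hS m hm1 hm fun _ => 1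
  have hy0 : y 0 = 1 := hys ⟨0, hm1⟩
  replace hlim := hlim y hys hy
  simp only [hy0, one_mul] at hy
  set f := PowerSeries.mk ω * PowerSeries.mk y with hf
  have hF : OnDisc f fun ζ => genFun ω ζ * genFun y ζ := hfac.onDisc.mul (onDisc_genFun hlim)
  obtain ⟨κ, hκ, hev⟩ := exists_source_ge θ hα0 hα1
  obtain ⟨K, hK⟩ := hω.exists_norm_genFun_le
  have hY := (tendsto_one_sub_mul_genFun hlim (norm_one (α := ℂ))).norm.const_mul K
  simp only [mul_one, norm_zero, mul_zero] at hY
  have hE : Tendsto (fun r : ℝ => (1 - r) ^ (1 - α) * ‖genFun ω r * genFun y r‖)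
      (𝓝[<] 1) (𝓝 0) := by
    refine squeeze_zero' ?_ ?_ hY
    · filter_upwards [self_mem_nhdsWithin] with r hr
      have : 0 < 1 - r := sub_pos.2 hr
      positivity
    · filter_upwards [hK, self_mem_nhdsWithin] with r hKr hr
      have h1 : 0 < 1 - r := sub_pos.2 hr
      rw [norm_mul, norm_mul, Complex.norm_real, Real.norm_of_nonneg h1.le]
      calc (1 - r) ^ (1 - α) * (‖genFun ω r‖ * ‖genFun y r‖)
          ≤ (1 - r) ^ (1 - α) * (K * (1 - r) ^ α * ‖genFun y r‖) := by gcongr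
        _ = K * ((1 - r) ^ (1 - α) * (1 - r) ^ α * ‖genFun y r‖) := by ring
        _ = K * ((1 - r) * ‖genFun y r‖) := by
            rw [← Real.rpow_add h1, sub_add_cancel, Real.rpow_one]
  have hinv : Tendsto (fun N : ℕ => 1 / (4 * (N : ℝ))) atTop (𝓝 0) := by
    simp only [one_div]
    exact (tendsto_natCast_atTop_atTop.const_mul_atTop (by norm_num)).inv_tendsto_atTop
  have hseq : Tendsto (fun N : ℕ => 1 - 1 / (4 * (N : ℝ))) atTop (𝓝[<] 1) := by
    refine tendsto_nhdsWithin_iff.2 ⟨by simpa using hinv.const_sub 1, ?_⟩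
    filter_upwards [eventually_gt_atTop 0] with N hN
    have : (0 : ℝ) < N := by exact_mod_cast hN
    have h1 : 0 < 1 / (4 * (N : ℝ)) := by positivity
    exact sub_lt_self 1 h1
  have hE' := hE.comp hseq
  set B := ∑ n ∈ Finset.range m, ‖coeff n f‖ with hB
  have hlow : Tendsto (fun N : ℕ => κ / 2 * (1 / 4) ^ (1 - α) - (1 / (4 * (N : ℝ))) ^ (1 - α) * B)
      atTop (𝓝 (κ / 2 * (1 / 4) ^ (1 - α))) := by
    have h1 := (hinv.rpow_const (p := 1 - α) (Or.inr (by linarith))).mul_const B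
    rw [Real.zero_rpow (by linarith), zero_mul] at h1
    simpa using h1.const_sub (κ / 2 * (1 / 4) ^ (1 - α))
  have hpos : 0 < κ / 2 * (1 / 4 : ℝ) ^ (1 - α) := by positivity
  -- At `r = 1 - 1 / (4N)`, scaling by `(1 - r)^(1 - α)` sends the upper bound to 0 and erases the
  -- finitely many initial terms, but leaves the lower bound a positive limit.
  refine absurd (le_of_tendsto_of_tendsto hlow hE' ?_) (not_le.2 hpos)
  filter_upwards [hev, eventually_ge_atTop m, eventually_ge_atTop 1] with N hN hmN hN1
  have h1 := le_norm_of_coeff_ge hF hmN hN1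
    (fun n hn => by
      rw [hy n hn]
      exact re_source_nonneg hα1 (hmθ'.trans_le (by exact_mod_cast hn)))
    (fun n hn1 hn2 => by
      rw [hy n (hmN.trans hn1)]
      exact hN n hn1 hn2)
  have hN0 : (0 : ℝ) < N := by exact_mod_cast hN1
  have h2 : (1 / (4 * (N : ℝ))) ^ (1 - α) * (N : ℝ) ^ (1 - α) = (1 / 4) ^ (1 - α) := by
    rw [← Real.mul_rpow (by positivity) (by positivity)]
    congr 1
    field_simp
  have h3 : 0 ≤ (1 / (4 * (N : ℝ))) ^ (1 - α) := by positivity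
  have h4 := mul_le_mul_of_nonneg_left h1 h3
  simp only [Function.comp_apply, sub_sub_cancel]
  refine le_trans (le_of_eq ?_) h4
  rw [← h2, ← hB]
  ring

/-! ### The two stability regions -/

theorem mem_closedDiscValues_inv {g : ℂ → ℂ} {z : ℂ} (hz : z ≠ 0)
    (h : z ∈ closedDiscValues g) : z⁻¹ ∈ closedDiscValues fun ζ => (g ζ)⁻¹ := by
  obtain ⟨ξ, hξ, hlim⟩ := h
  exact ⟨ξ, hξ, hlim.inv₀ hz⟩

end SCQ

theorem theorem4 (α θ : ℝ) (hα0 : 0 < α) (hα1 : α < 1) (p : ℕ) (hp : 1 ≤ p) :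
    (∀ ω : ℕ → ℂ, SCQ.IsWeights (-α) ω → SCQ.NoCommonZero θ p ω →
      SCQ.stabilityRegionI α θ p ω =
        Set.univ \ SCQ.closedDiscValues
          (fun ξ => SCQ.genFun ω ξ / ∑ j ∈ Finset.range p, SCQ.shiftCoeff θ p j * ξ ^ j)) ∧
    (∀ ω : ℕ → ℂ, SCQ.IsWeights α ω → SCQ.NoCommonZero θ p ω →
      SCQ.stabilityRegionII α θ p ω =
        Set.univ \ SCQ.closedDiscValues
          (fun ξ => (∑ j ∈ Finset.range p, SCQ.shiftCoeff θ p j * ξ ^ j) / SCQ.genFun ω ξ)) := by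
  simp only [SCQ.sum_shiftCoeff]
  have hM1 : ∀ᶠ m : ℕ in atTop, p ≤ m + 1 := by
    filter_upwards [eventually_ge_atTop p] with m hm
    omega
  have hM2 : ∀ᶠ m : ℕ in atTop, θ < m := tendsto_natCast_atTop_atTop.eventually_gt_atTop θ
  refine ⟨fun ω hω hcz => ?_, fun ω hω hcz => ?_⟩
  · obtain ⟨φ, ψ, P, N, hfac, -, hfac1⟩ := hω.exists_factorization
    obtain ⟨hP1, hN1⟩ := hfac1 (neg_lt_zero.2 hα0)
    ext z
    rw [SCQ.mem_stabilityRegionI]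
    simp only [Set.mem_sdiff, Set.mem_univ, true_and]
    rcases eq_or_ne z 0 with rfl | hz
    · have h1 : SCQ.symbol θ p ω 1 (-0) = PowerSeries.mk ω := by simp [SCQ.symbol]
      rw [h1]
      -- The value 0 is attained at `ξ = 1`, where `ω` vanishes and `Θ` equals 1.
      refine iff_of_false (hω.not_isStable hα0 hα1 (hM1.and hM2)) (not_not.2 ⟨1, by simp, ?_⟩)
      have h2 := (hfac.tendsto_genFun (ξ := 1) (by simp) hP1).div
        (SCQ.tendsto_eval (SCQ.shiftPoly θ p) 1) (by simp [SCQ.eval_one_shiftPoly θ hp])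
      rwa [hN1, zero_div, zero_div] at h2
    · rw [SCQ.isStable_symbol_iff hfac hp hcz (Or.inr hN1) one_ne_zero (neg_ne_zero.2 hz)
        (hM1.and hM2) (SCQ.tendsto_source θ hα0 hα1)]
      simp
  · obtain ⟨φ, ψ, P, N, hfac, hfac1, -⟩ := hω.exists_factorization
    have hP1 := hfac1 hα0
    ext z
    rw [SCQ.mem_stabilityRegionII]
    simp only [Set.mem_sdiff, Set.mem_univ, true_and]
    rcases eq_or_ne z 0 with rfl | hz
    · refine iff_of_false (fun h => h.1 rfl) (not_not.2 ⟨1, by simp, ?_⟩)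
      have h1 := (SCQ.tendsto_eval (SCQ.shiftPoly θ p) 1).mul
        (hfac.tendsto_inv_genFun (ξ := 1) (by simp) (hfac.num_ne_zero 1 (by simp) hP1))
      rw [hP1, zero_div, mul_zero] at h1
      simpa only [div_eq_mul_inv] using h1
    -- The criterion concerns the value `1 / z` of `ω / Θ`; as `z ≠ 0`, inversion carries it to the
    -- value `z` of `Θ / ω`.
    · rw [SCQ.isStable_symbol_iff (c := 0) hfac hp hcz (Or.inl hP1) hz (neg_ne_zero.2 one_ne_zero)
        hM1 tendsto_const_nhds, neg_neg, one_div]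
      refine (and_iff_right hz).trans (not_congr ⟨fun h => ?_, fun h => ?_⟩)
      · simpa using SCQ.mem_closedDiscValues_inv (inv_ne_zero hz) h
      · simpa using SCQ.mem_closedDiscValues_inv hz h
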